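/- Let $n\ge 1$, let $\Lambda_1,\Lambda_2\subset\mathbf R^n$ be lattices (discrete subgroups of full rank), and let $T_i=\mathbf R^n/\Lambda_i$ be the corresponding flat tori, with the flat Riemannian metric, Riemannian measure $\mu_{T_i}$ and Laplace--Beltrami operator $\Delta_{T_i}=-\sum_k\partial_k^2$. For a flat torus $T$ of dimension $n$ and a smooth real-valued function $a\in C^\infty(T)$, let $$\zeta_{T,a}(s)=\mathrm{tr}\bigl(a\,\Delta_T^{-s}\bigr)\qquad(\mathrm{Re}(s)>n/2),$$ where the trace is taken in $L^2(T,\mu_T)$, $a$ acts by multiplication, and $\Delta_T^{-s}$ acts as multiplication by $\lambda^{-s}$ on the eigenspace of each eigenvalue $\lambda>0$ of $\Delta_T$ and as $0$ on the kernel of $\Delta_T$; denote also by $\zeta_{T,a}$ the meromorphic continuation to $\mathbf C$. Let $\varphi:T_1\to T_2$ be a smooth diffeomorphism, and for $a_0\in C^\infty(T_2)$ let $\varphi^*(a_0)=a_0\circ\varphi$. Then the following are equivalent: (i) $\zeta_{T_2,a_0}=\zeta_{T_1,\varphi^*(a_0)}$ for all $a_0\in C^\infty(T_2)$; (ii) $T_1$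 and $T_2$ are isospectral, that is, $\Delta_{T_1}$ and $\Delta_{T_2}$ have the same eigenvalues with the same multiplicities, and $\varphi$ has jacobian $w_\varphi=1$ everywhere on $T_1$, where $w_\varphi(x)=|\det J_\varphi(x)|$, with $J_\varphi(x)$ the jacobian matrix of $\varphi$ at $x$ in the Euclidean coordinates of the two tori (equivalently, $w_\varphi$ is the density in $\int_{T_2}a_0\,d\mu_{T_2}=\int_{T_1}\varphi^*(a_0)\,w_\varphi\,d\mu_{T_1}$). -/

import Mathlib

open scoped Manifold ContDiff Topology

noncomputable section

namespace FlatTorus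

/-- Euclidean space `ℝⁿ`. -/
abbrev E (n : ℕ) := EuclideanSpace ℝ (Fin n)

variable {n : ℕ}

/-- The torus `ℝⁿ / Λ`, with the quotient topology and the Borel σ-algebra. -/
abbrev Torus (Λ : Submodule ℤ (E n)) := E n ⧸ Λ.toAddSubgroup

/-- The projection `ℝⁿ → ℝⁿ / Λ`. -/
def proj (Λ : Submodule ℤ (E n)) : E n → Torus Λ := fun x => (x : E n ⧸ Λ.toAddSubgroup)

lemma proj_surjective (Λ : Submodule ℤ (E n)) : Function.Surjective (proj Λ) :=
  QuotientAddGroup.mk_surjective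

lemma proj_eq_iff {Λ : Submodule ℤ (E n)} {x y : E n} : proj Λ x = proj Λ y ↔ y - x ∈ Λ := by
  unfold proj
  rw [QuotientAddGroup.eq, neg_add_eq_sub]
  rfl

section Manifold

variable (Λ : Submodule ℤ (E n)) [DiscreteTopology Λ]

lemma proj_isLocalHomeomorph : IsLocalHomeomorph (proj Λ) := by
  have h : IsDiscrete (Λ.toAddSubgroup : Set (E n)) := ⟨inferInstanceAs (DiscreteTopology Λ)⟩
  exact (AddSubgroup.isAddQuotientCoveringMap_of_comm Λ.toAddSubgroup h).isCoveringMap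
    |>.isLocalHomeomorph

/-- The manifold structure of the torus: the charts are local inverses of the projection. -/
instance instChartedSpace : ChartedSpace (E n) (Torus Λ) :=
  (proj_isLocalHomeomorph Λ).chartedSpace (proj_surjective Λ)

lemma proj_chart_apply {e : OpenPartialHomeomorph (Torus Λ) (E n)} (he : e ∈ atlas (E n) (Torus Λ))
    {p : Torus Λ} (hp : p ∈ e.source) : proj Λ (e p) = p := by
  obtain ⟨q, rfl⟩ := he
  simp only [chartAt_self_eq, OpenPartialHomeomorph.trans_refl] at hp ⊢
  exact (proj_isLocalHomeomorph Λ).apply_localInverseAt_of_mem hp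

lemma chart_symm_apply {e : OpenPartialHomeomorph (Torus Λ) (E n)} (he : e ∈ atlas (E n) (Torus Λ))
    (x : E n) : e.symm x = proj Λ x := by
  obtain ⟨q, rfl⟩ := he
  rw [chartAt_self_eq, OpenPartialHomeomorph.trans_refl]
  exact congrFun ((proj_isLocalHomeomorph Λ).localInverseAt_symm _) x

/-- A continuous map that differs from the identity by elements of `Λ` is locally a translation. -/
lemma eventually_eq_add {Λ : Submodule ℤ (E n)} [DiscreteTopology Λ] {h : E n → E n} {x : E n}
    {s : Set (E n)} (hs : IsOpen s) (hx : x ∈ s) (hc : ContinuousOn h s)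
    (hh : ∀ y ∈ s, h y - y ∈ Λ) : ∀ᶠ y in 𝓝 x, h y = y + (h x - x) := by
  have hd : ∃ U ∈ 𝓝 (h x - x), ∀ z ∈ U, z ∈ Λ → z = h x - x := by
    have h1 : ({⟨h x - x, hh x hx⟩} : Set Λ) ∈ 𝓝 (⟨h x - x, hh x hx⟩ : Λ) := by simp
    rw [nhds_subtype, Filter.mem_comap] at h1
    obtain ⟨U, hU, hU'⟩ := h1
    refine ⟨U, hU, fun z hz hzΛ => ?_⟩
    have := @hU' ⟨z, hzΛ⟩ hz
    simpa using congrArg Subtype.val this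
  obtain ⟨U, hU, hU'⟩ := hd
  have hc' : ContinuousAt (fun y => h y - y) x :=
    (hc.continuousAt (hs.mem_nhds hx)).sub continuousAt_id
  filter_upwards [hc'.preimage_mem_nhds hU, hs.mem_nhds hx] with y hy hys
  rw [← hU' _ hy (hh y hys), add_sub_cancel]

instance instIsManifold : IsManifold 𝓘(ℝ, E n) ∞ (Torus Λ) := by
  apply isManifold_of_contDiffOn
  intro e e' he he'
  simp only [modelWithCornersSelf_coe, modelWithCornersSelf_coe_symm, Function.id_comp,
    Function.comp_id, Set.preimage_id, Set.range_id, Set.inter_univ]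
  intro x hx
  have hopen : IsOpen (e.symm.trans e').source := (e.symm.trans e').open_source
  have key := eventually_eq_add (Λ := Λ) (h := e.symm.trans e') hopen hx
    (e.symm.trans e').continuousOn (by
      intro y hy
      have h1 : e.symm y ∈ e'.source := by
        rw [OpenPartialHomeomorph.trans_source] at hy; exact hy.2
      have h2 := proj_chart_apply Λ he' h1
      rw [chart_symm_apply Λ he] at h2
      rw [← proj_eq_iff, ← h2, OpenPartialHomeomorph.coe_trans, Function.comp_apply,
        chart_symm_apply Λ he])
  refine ContDiffAt.contDiffWithinAt ?_
  refine ContDiffAt.congr_of_eventuallyEq ?_ key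
  exact contDiffAt_id.add contDiffAt_const

lemma contMDiff_proj : ContMDiff 𝓘(ℝ, E n) 𝓘(ℝ, E n) ∞ (proj Λ) := by
  intro x
  have hl := proj_isLocalHomeomorph Λ
  let c := chartAt (E n) (proj Λ x)
  have hc : c ∈ atlas (E n) (Torus Λ) := chart_mem_atlas _ _
  have hsrc : proj Λ x ∈ c.source := mem_chart_source _ _
  rw [contMDiffAt_iff]
  refine ⟨hl.continuous.continuousAt, ?_⟩
  simp only [mfld_simps, contDiffWithinAt_univ]
  have hopen : IsOpen (proj Λ ⁻¹' c.source) := c.open_source.preimage hl.continuous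
  have key := eventually_eq_add (Λ := Λ) (h := c ∘ proj Λ) hopen hsrc
    (c.continuousOn.comp hl.continuous.continuousOn (fun _ h => h)) (by
      intro y hy
      rw [← proj_eq_iff, Function.comp_apply, proj_chart_apply Λ hc hy])
  exact (contDiffAt_id.add contDiffAt_const).congr_of_eventuallyEq key

end Manifold

section Spectral

variable (Λ : Submodule ℤ (E n)) [DiscreteTopology Λ]

/-- The Laplace-Beltrami operator of the flat metric, `-∑ₖ ∂ₖ²`, computed on the universal cover;
for the `Λ`-periodic function `f ∘ proj Λ` the choice of the point above `p` is immaterial. -/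
def laplaceBeltrami (f : Torus Λ → ℂ) : Torus Λ → ℂ :=
  fun p => -(Laplacian.laplacian (f ∘ proj Λ)) (Quotient.out p)

variable [IsZLattice ℝ Λ]

/-- The Riemannian measure of the flat torus: Lebesgue measure on a fundamental parallelotope of
`Λ`, pushed forward to the quotient (it does not depend on the parallelotope). -/
def vol : MeasureTheory.Measure (Torus Λ) :=
  MeasureTheory.Measure.map (proj Λ) (MeasureTheory.volume.restrict
    (ZSpan.fundamentalDomain ((Module.Free.chooseBasis ℤ Λ).ofZLatticeBasis ℝ)))

/-- The complex Hilbert space `L²(T)`. -/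
abbrev L2 := MeasureTheory.Lp ℂ 2 (vol Λ)

/-- The space of smooth solutions of `Δ f = ev • f`, as a subspace of `L²(T)`. -/
def eigenspace (ev : ℝ) : Submodule ℂ (L2 Λ) where
  carrier := {u | ∃ f : Torus Λ → ℂ, ContMDiff 𝓘(ℝ, E n) 𝓘(ℝ, ℂ) ∞ f ∧
    (∀ p, laplaceBeltrami Λ f p = (ev : ℂ) * f p) ∧ u =ᵐ[vol Λ] f}
  zero_mem' := by
    refine ⟨fun _ => 0, contMDiff_const, fun p => ?_, MeasureTheory.Lp.coeFn_zero _ _ _⟩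
    have : ((fun _ => 0 : Torus Λ → ℂ) ∘ proj Λ) = fun _ => 0 := rfl
    simp [laplaceBeltrami, this]
  add_mem' := by
    rintro u v ⟨f, hf, hf', hu⟩ ⟨g, hg, hg', hv⟩
    refine ⟨f + g, hf.add hg, fun p => ?_, (MeasureTheory.Lp.coeFn_add u v).trans (hu.add hv)⟩
    have hF : ContDiff ℝ ∞ (f ∘ proj Λ) := (hf.comp (contMDiff_proj Λ)).contDiff
    have hG : ContDiff ℝ ∞ (g ∘ proj Λ) := (hg.comp (contMDiff_proj Λ)).contDiff
    have h2 : (2 : ℕ∞ω) ≤ ∞ := 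
      WithTop.coe_le_coe.2 (le_top : (2 : ℕ∞) ≤ ⊤)
    have hp := hf' p
    have hq := hg' p
    simp only [laplaceBeltrami] at hp hq ⊢
    have : ((f + g) ∘ proj Λ) = (f ∘ proj Λ) + (g ∘ proj Λ) := rfl
    rw [this, (hF.of_le h2).contDiffAt.laplacian_add (hG.of_le h2).contDiffAt, neg_add, hp, hq,
      Pi.add_apply, mul_add]
  smul_mem' := by
    rintro c u ⟨f, hf, hf', hu⟩
    have hF : ContDiff ℝ ∞ (f ∘ proj Λ) := (hf.comp (contMDiff_proj Λ)).contDiff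
    have h2 : (2 : ℕ∞ω) ≤ ∞ := 
      WithTop.coe_le_coe.2 (le_top : (2 : ℕ∞) ≤ ⊤)
    refine ⟨c • f, ?_, fun p => ?_, (MeasureTheory.Lp.coeFn_smul c u).trans (hu.const_smul c)⟩
    · exact ((contDiff_const_smul c).contMDiff (n := ∞)).comp hf
    · have hp := hf' p
      simp only [laplaceBeltrami] at hp ⊢
      have : ((c • f) ∘ proj Λ) = c • (f ∘ proj Λ) := rfl
      rw [this, InnerProductSpace.laplacian_smul c (hF.of_le h2).contDiffAt, ← smul_neg, hp,
        Pi.smul_apply, smul_eq_mul, smul_eq_mul, mul_left_comm]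

/-- The orthogonal projection of `L²(T)` to an eigenspace. The eigenspaces are finite-dimensional,
hence equal to their closures. -/
def eigenproj (ev : ℝ) : L2 Λ →L[ℂ] L2 Λ :=
  (eigenspace Λ ev).topologicalClosure.starProjection

/-- The operator `Δ^{-s}` of spectral theory, with `0` on the kernel of `Δ`: it multiplies by
`ev ^ (-s)` on the eigenspace of each eigenvalue `ev > 0`. -/
def powLaplace (s : ℂ) (u : L2 Λ) : L2 Λ :=
  ∑' ev : Set.Ioi (0 : ℝ), (((ev : ℝ) : ℂ) ^ (-s)) • eigenproj Λ (ev : ℝ) u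

/-- The trace `∑ᵢ ⟨bᵢ, a Δ^{-s} bᵢ⟩` in `L²(T)` of the operator `a Δ^{-s}`, taken in a Hilbert
basis `b`. The operator is of trace class for `Re s > n / 2`, so the basis is immaterial there. -/
def zetaTrace (a : C^∞⟮𝓘(ℝ, E n), Torus Λ; ℝ⟯) (s : ℂ) : ℂ :=
  let b := (exists_hilbertBasis ℂ (L2 Λ)).choose_spec.choose
  ∑' i, ∫ p, (starRingEnd ℂ) (b i p) * ((a p : ℂ) * powLaplace Λ s (b i) p) ∂(vol Λ)

/-- `F` is a meromorphic function on `ℂ` (with the value `0` at its poles) that is equal to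
`tr(a Δ^{-s})` on the half-plane `Re s > n / 2`. There is at most one such `F`. -/
def IsZeta (a : C^∞⟮𝓘(ℝ, E n), Torus Λ; ℝ⟯) (F : ℂ → ℂ) : Prop :=
  MeromorphicNFOn F Set.univ ∧ ∀ s : ℂ, (n : ℝ) / 2 < s.re → F s = zetaTrace Λ a s

open Classical in
/-- The zeta function `ζ_{T,a}(s) = tr(a Δ^{-s})`, a meromorphic function on `ℂ`. (If there were
no meromorphic continuation, this would be the function on the half-plane `Re s > n / 2`.) -/
def zeta (a : C^∞⟮𝓘(ℝ, E n), Torus Λ; ℝ⟯) : ℂ → ℂ :=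
  if h : ∃ F, IsZeta Λ a F then h.choose
  else fun s => if (n : ℝ) / 2 < s.re then zetaTrace Λ a s else 0

/-- The Laplace operators of the two tori have the same eigenvalues with the same
multiplicities. -/
def Isospectral (Λ₁ Λ₂ : Submodule ℤ (E n)) [DiscreteTopology Λ₁] [IsZLattice ℝ Λ₁]
    [DiscreteTopology Λ₂] [IsZLattice ℝ Λ₂] : Prop :=
  ∀ ev : ℝ, Module.rank ℂ (eigenspace Λ₁ ev) = Module.rank ℂ (eigenspace Λ₂ ev)

end Spectral

/-- The jacobian `w_φ = |det J_φ|` of a map of flat tori. The derivative is expressed in the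
preferred charts, which are local inverses of the projections and hence local isometries with
Euclidean space, so that the metrics contribute the factor `√(det g₂ / det g₁) = 1`. -/
def jacobian {Λ₁ Λ₂ : Submodule ℤ (E n)} [DiscreteTopology Λ₁] [DiscreteTopology Λ₂]
    (φ : Torus Λ₁ → Torus Λ₂) (p : Torus Λ₁) : ℝ :=
  let J : E n →L[ℝ] E n := mfderiv 𝓘(ℝ, E n) 𝓘(ℝ, E n) φ p
  |J.det|

end FlatTorus

end

noncomputable section

namespace FlatTorus

open MeasureTheory Filter

/-! ### Dual lattices and covolumes -/

section Lattice

variable {n : ℕ}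

/-! The characters `exp (2πi⟨ξ, x⟩)`, with `ξ` in the dual lattice, are orthogonal and complete in
`L²(T)`, and are eigenfunctions of the Laplacian with eigenvalue `4π²‖ξ‖²`. They have modulus one at
every point, so each diagonal coefficient of multiplication by `a` in the normalized characters is
the mean value of `a`, whatever `ξ` is. The trace therefore factors for `Re s > n / 2`
(`zetaTrace_eq`): `tr(a Δ^{-s})` is the mean of `a` times the sum of `(4π²‖ξ‖²)^(-s)` over `ξ ≠ 0`.

With `a₀ = 1`, equality of the zeta functions is equality of these two Dirichlet series, which
determine their exponents with multiplicities (`ncard_eq_of_tsum_rpow_eq`); this is isospectrality.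
Dividing by the common series at a real point, where it is positive, leaves the statement that `a₀`
and `a₀ ∘ φ` have the same mean (`forall_zetaTrace_eq_iff`).

Isospectral tori have equal volumes: the spectrum counts dual lattice vectors by length, and the
asymptotics of this count give the covolume of the dual lattice (`covolume_eq_of_equiv`), hence that
of the lattice (`covolume_mul_covolume_dual`). Equality of means is then equality of integrals. By
the change of variables formula (`integral_comp_mul_jacobian`) this says that `w_φ` and `1` have the
same integral against every smooth function, so they agree everywhere by continuity
(`forall_integral_eq_iff_jacobian`).

The meromorphic continuation need not be constructed: the traces on the half-plane determine `zeta`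
(`zeta_eq_zeta_iff`). -/

lemma nondegenerate_inner : (innerₗ (E n)).Nondegenerate := by
  constructor
  · intro x hx
    exact inner_self_eq_zero.1 (hx x)
  · intro x hx
    exact inner_self_eq_zero.1 (hx x)

/-- The dual lattice: the vectors whose inner product with every element of `Λ` is an integer. -/
def dual (Λ : Submodule ℤ (E n)) : Submodule ℤ (E n) :=
  LinearMap.BilinForm.dualSubmodule (innerₗ (E n)) Λ

lemma mem_dual {Λ : Submodule ℤ (E n)} {ξ : E n} :
    ξ ∈ dual Λ ↔ ∀ x ∈ Λ, ∃ k : ℤ, inner ℝ ξ x = k := by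
  simp only [dual, LinearMap.BilinForm.mem_dualSubmodule, Submodule.mem_one, innerₗ_apply_apply]
  simp [eq_comm]

variable (Λ : Submodule ℤ (E n)) [DiscreteTopology Λ] [IsZLattice ℝ Λ]

/-- A `ℤ`-basis of a lattice, indexed by `Fin n`. -/
def latticeBasis : Module.Basis (Fin n) ℤ Λ :=
  (Module.Free.chooseBasis ℤ Λ).reindex
    (((Module.Free.chooseBasis ℤ Λ).ofZLatticeBasis ℝ).indexEquiv
      (EuclideanSpace.basisFun (Fin n) ℝ).toBasis)

/-- The basis of `ℝⁿ` dual to a basis of the lattice. -/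
def dualBasis : Module.Basis (Fin n) ℝ (E n) :=
  LinearMap.BilinForm.dualBasis (innerₗ (E n)) nondegenerate_inner
    ((latticeBasis Λ).ofZLatticeBasis ℝ)

lemma inner_dualBasis (i j : Fin n) :
    inner ℝ (dualBasis Λ i) (latticeBasis Λ j : E n) = if j = i then 1 else 0 := by
  have := LinearMap.BilinForm.apply_dualBasis_left (B := innerₗ (E n)) nondegenerate_inner
    ((latticeBasis Λ).ofZLatticeBasis ℝ) i j
  simpa [dualBasis] using this

lemma dual_eq_span : dual Λ = Submodule.span ℤ (Set.range (dualBasis Λ)) := by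
  rw [dualBasis, ← LinearMap.BilinForm.dualSubmodule_span_of_basis,
    Module.Basis.ofZLatticeBasis_span, dual]

instance : DiscreteTopology (dual Λ) := by
  rw [dual_eq_span]; infer_instance

instance : IsZLattice ℝ (dual Λ) := by
  constructor
  rw [dual_eq_span, Submodule.span_span_of_tower, (dualBasis Λ).span_eq]

/-- Pairing with the dual basis reads off the coordinates in the lattice basis. This half of
biduality makes the characters separate points of the torus. -/
lemma mem_of_inner_dual {x : E n} (h : ∀ ξ ∈ dual Λ, ∃ k : ℤ, inner ℝ ξ x = k) : x ∈ Λ := by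
  have hb : ∀ i, ∃ k : ℤ, inner ℝ (dualBasis Λ i) x = k := fun i =>
    h _ (by rw [dual_eq_span]; exact Submodule.subset_span ⟨i, rfl⟩)
  let b := (latticeBasis Λ).ofZLatticeBasis ℝ
  have hr : ∀ i, inner ℝ (dualBasis Λ i) x = b.repr x i := by
    intro i
    conv_lhs => rw [← b.sum_repr x]
    simp [inner_sum, inner_smul_right, b, inner_dualBasis]
  have : x ∈ Submodule.span ℤ (Set.range b) := by
    rw [b.mem_span_iff_repr_mem ℤ]
    intro i
    obtain ⟨k, hk⟩ := hb i
    exact ⟨k, by rw [← hr, hk]; rfl⟩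
  rwa [Module.Basis.ofZLatticeBasis_span] at this

/-- In orthonormal coordinates the transpose of one of two dual bases' matrices inverts the other,
so the determinants have product 1. What matters later is only that the right-hand side does not
depend on `Λ`. -/
lemma covolume_mul_covolume_dual : ZLattice.covolume Λ * ZLattice.covolume (dual Λ) =
    (volume.real (ZSpan.fundamentalDomain (EuclideanSpace.basisFun (Fin n) ℝ).toBasis)) ^ 2 := by
  let b₀ := (EuclideanSpace.basisFun (Fin n) ℝ)
  have hd : ZLattice.covolume (dual Λ) = |b₀.toBasis.det (dualBasis Λ)| *
      volume.real (ZSpan.fundamentalDomain b₀.toBasis) := by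
    have hinj : LinearIndependent ℤ (dualBasis Λ) :=
      (dualBasis Λ).linearIndependent.restrict_scalars (fun a b h => by simpa using h)
    let c : Module.Basis (Fin n) ℤ (dual Λ) :=
      (Module.Basis.span hinj).map (LinearEquiv.ofEq _ _ (dual_eq_span Λ).symm)
    rw [ZLattice.covolume_eq_det_mul_measureReal (dual Λ) volume c b₀.toBasis]
    have hc : Subtype.val ∘ c = dualBasis Λ := by
      funext i
      simp [c, Module.Basis.span_apply]
    rw [hc]
  rw [ZLattice.covolume_eq_det_mul_measureReal Λ volume (latticeBasis Λ) b₀.toBasis, hd,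
    mul_mul_mul_comm, ← abs_mul, ← sq]
  suffices h : b₀.toBasis.det (Subtype.val ∘ latticeBasis Λ) * b₀.toBasis.det (dualBasis Λ) = 1 by
    rw [h, abs_one, one_mul]
  rw [Module.Basis.det_apply, Module.Basis.det_apply, mul_comm,
    ← Matrix.det_transpose (b₀.toBasis.toMatrix (dualBasis Λ)), ← Matrix.det_mul]
  convert Matrix.det_one (n := Fin n) (R := ℝ) using 2
  ext i j
  rw [Matrix.mul_apply, Matrix.one_apply]
  have := inner_dualBasis Λ i j
  rw [PiLp.inner_apply] at this
  simp only [eq_comm (a := j)] at this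
  rw [← this]
  refine Finset.sum_congr rfl fun k _ => ?_
  simp [Module.Basis.toMatrix_apply, b₀, mul_comm]

lemma finite_norm_le (Λ : Submodule ℤ (E n)) [DiscreteTopology Λ] (R : ℝ) :
    {ξ : Λ | ‖ξ‖ ≤ R}.Finite := by
  have H : IsClosed (X := E n) Λ := @AddSubgroup.isClosed_of_discrete _ _ _ _ _
    Λ.toAddSubgroup (inferInstanceAs (DiscreteTopology Λ))
  refine ((Metric.finite_isBounded_inter_isClosed DiscreteTopology.isDiscrete
    (Metric.isBounded_closedBall (x := (0 : E n)) (r := R)) H).preimage_embedding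
    (.subtype _)).subset ?_
  intro t ht
  simpa using ht

/-- Lattices whose numbers of vectors of each length are the same have the same covolume. -/
lemma covolume_eq_of_equiv (hn : 0 < n) {Λ Λ' : Submodule ℤ (E n)} [DiscreteTopology Λ]
    [IsZLattice ℝ Λ] [DiscreteTopology Λ'] [IsZLattice ℝ Λ'] (e : Λ ≃ Λ')
    (he : ∀ ξ, ‖e ξ‖ = ‖ξ‖) : ZLattice.covolume Λ = ZLattice.covolume Λ' := by
  have : Nontrivial (E n) := by
    have : Nonempty (Fin n) := ⟨⟨0, hn⟩⟩
    infer_instance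
  -- The counting theorem requires a function homogeneous of degree equal to the dimension, hence
  -- the power of the norm. The number of lattice points where it is at most `c`, divided by `c`,
  -- tends to the volume of the unit ball over the covolume.
  have hset : {x : E n | x ∈ (Set.univ : Set (E n)) ∧ ‖x‖ ^ Module.finrank ℝ (E n) ≤ 1} =
      Metric.closedBall 0 1 := by
    ext x
    simp [pow_le_one_iff_of_nonneg (norm_nonneg x) hn.ne']
  have key (L : Submodule ℤ (E n)) [DiscreteTopology L] [IsZLattice ℝ L] :=
    ZLattice.covolume.tendsto_card_le_div' L (X := Set.univ)
      (F := fun x => ‖x‖ ^ Module.finrank ℝ (E n)) (fun _ _ _ _ => trivial)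
      (fun x r hr => by rw [norm_smul, mul_pow, Real.norm_of_nonneg hr])
      (by rw [hset]; exact Metric.isBounded_closedBall)
      (by rw [hset]; exact measurableSet_closedBall)
      (by rw [hset, frontier_closedBall _ one_ne_zero]
          exact Measure.addHaar_sphere _ _ _)
  have h1 := key Λ
  have h2 := key Λ'
  have hcard : ∀ c : ℝ, Nat.card ↑({x : E n | x ∈ (Set.univ : Set (E n)) ∧
      ‖x‖ ^ Module.finrank ℝ (E n) ≤ c} ∩ (Λ : Set (E n))) =
      Nat.card ↑({x : E n | x ∈ (Set.univ : Set (E n)) ∧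
      ‖x‖ ^ Module.finrank ℝ (E n) ≤ c} ∩ (Λ' : Set (E n))) := by
    intro c
    refine Nat.card_congr ⟨fun x => ⟨e ⟨x, x.2.2⟩, ⟨trivial, ?_⟩, (e _).2⟩,
      fun x => ⟨e.symm ⟨x, x.2.2⟩, ⟨trivial, ?_⟩, (e.symm _).2⟩, ?_, ?_⟩
    · have := he ⟨x, x.2.2⟩
      rw [Submodule.coe_norm, Submodule.coe_norm] at this
      rw [this]
      exact x.2.1.2
    · have := he (e.symm ⟨x, x.2.2⟩)
      rw [Equiv.apply_symm_apply, Submodule.coe_norm, Submodule.coe_norm] at this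
      rw [← this]
      exact x.2.1.2
    · intro x; simp
    · intro x; simp
  simp only [hcard] at h1
  have h := tendsto_nhds_unique h1 h2
  have hv : volume.real (Metric.closedBall (0 : E n) 1) ≠ 0 := by
    rw [measureReal_ne_zero_iff (by exact measure_closedBall_lt_top.ne)]
    exact (Metric.measure_closedBall_pos _ _ one_pos).ne'
  rw [hset, div_eq_div_iff (ZLattice.covolume_ne_zero _ _) (ZLattice.covolume_ne_zero _ _)] at h
  exact (mul_left_cancel₀ hv h).symm

end Lattice

/-! ### Generalized Dirichlet series determine their exponents -/

section Dirichlet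

variable {ι κ : Type*}

/-- Two families with the same finite multiplicities at the values satisfying `P` are, on these
values, reindexings of each other. -/
lemma exists_equiv_of_card_fiber_eq {f : ι → ℝ} {g : κ → ℝ}
    (hf : ∀ r, {i | f i = r}.Finite) (hg : ∀ r, {i | g i = r}.Finite) {P : ℝ → Prop}
    (h : ∀ r, P r → {i | f i = r}.ncard = {i | g i = r}.ncard) :
    ∃ e : {i // P (f i)} ≃ {i // P (g i)}, ∀ i, g (e i) = f i := by
  have key : ∀ r : ℝ, Nonempty
      ({i : {i // P (f i)} // f i = r} ≃ {i : {i // P (g i)} // g i = r}) := by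
    intro r
    by_cases hr : P r
    · have e1 : {i : {i // P (f i)} // f i = r} ≃ {i | f i = r} :=
        Equiv.subtypeSubtypeEquivSubtype (p := fun i => P (f i)) (q := fun i => f i = r)
          (fun {x} hx => by rw [hx]; exact hr)
      have e2 : {i : {i // P (g i)} // g i = r} ≃ {i | g i = r} :=
        Equiv.subtypeSubtypeEquivSubtype (p := fun i => P (g i)) (q := fun i => g i = r)
          (fun {x} hx => by rw [hx]; exact hr)
      have := (hf r).to_subtype
      have := (hg r).to_subtype
      obtain ⟨e⟩ := (Finite.card_eq (α := {i | f i = r}) (β := {i | g i = r})).1 (h r hr)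
      exact ⟨e1.trans (e.trans e2.symm)⟩
    · have h1 : IsEmpty {i : {i // P (f i)} // f i = r} := ⟨fun i => hr (i.2 ▸ i.1.2)⟩
      have h2 : IsEmpty {i : {i // P (g i)} // g i = r} := ⟨fun i => hr (i.2 ▸ i.1.2)⟩
      exact ⟨Equiv.equivOfIsEmpty _ _⟩
  have e := fun r => (key r).some
  exact ⟨Equiv.ofFiberEquiv (f := fun i : {i // P (f i)} => f i)
      (g := fun i : {i // P (g i)} => g i) e,
    fun i => Equiv.ofFiberEquiv_map (f := fun i : {i // P (f i)} => f i)
      (g := fun i : {i // P (g i)} => g i) e i⟩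

/-- Multiplicities of the leading exponent as a limit of a generalized Dirichlet series. -/
lemma tendsto_tsum_div_rpow {f : ι → ℝ} {r s₀ : ℝ} (hr : 0 < r)
    (hfin : {i | f i = r}.Finite) (hf : ∀ i, r ≤ f i) (hsum : Summable fun i => f i ^ (-s₀)) :
    Tendsto (fun s : ℝ => ∑' i, (f i / r) ^ (-s)) atTop (𝓝 ({i | f i = r}.ncard : ℝ)) := by
  classical
  have h1 : ∀ i, 1 ≤ f i / r := fun i => (one_le_div hr).2 (hf i)
  -- The bases are at least 1, so for `s ≥ s₀` the terms at `s₀` dominate. Terms with `f i = r` are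
  -- constantly 1; all others tend to 0.
  have hlim := tendsto_tsum_of_dominated_convergence (𝓕 := atTop) (β := ι)
    (f := fun (s : ℝ) i => (f i / r) ^ (-s)) (g := fun i => if f i = r then (1 : ℝ) else 0)
    (bound := fun i => (f i / r) ^ (-s₀)) ?_ ?_ ?_
  · convert hlim using 2
    rw [tsum_eq_sum (s := hfin.toFinset) (by intro i hi; simpa using hi),
      Finset.sum_congr rfl (g := fun _ => (1 : ℝ)) (by intro i hi; simpa using hi)]
    rw [Set.ncard_eq_toFinset_card _ hfin]
    simp
  · have : (fun i => (f i / r) ^ (-s₀)) = fun i => f i ^ (-s₀) * (r ^ (-s₀))⁻¹ := by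
      ext i
      rw [Real.div_rpow (hr.le.trans (hf i)) hr.le, div_eq_mul_inv]
    rw [this]
    exact hsum.mul_right _
  · intro i
    by_cases h : f i = r
    · simp [h, hr.ne']
    · have : 1 < f i / r := (one_lt_div hr).2 (lt_of_le_of_ne (hf i) (Ne.symm h))
      simp only [if_neg h]
      simp_rw [Real.rpow_neg (zero_le_one.trans (h1 i))]
      exact (tendsto_rpow_atTop_of_base_gt_one _ this).inv_tendsto_atTop
  · filter_upwards [eventually_ge_atTop s₀] with s hss i
    rw [Real.norm_of_nonneg (Real.rpow_nonneg (zero_le_one.trans (h1 i)) _)]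
    exact Real.rpow_le_rpow_of_exponent_le (h1 i) (by linarith)

/-- A generalized Dirichlet series determines the multiplicities of its exponents. -/
theorem ncard_eq_of_tsum_rpow_eq {f : ι → ℝ} {g : κ → ℝ} {s₀ : ℝ}
    (hf : ∀ i, 0 < f i) (hg : ∀ i, 0 < g i)
    (hff : ∀ r, {i | f i ≤ r}.Finite) (hgf : ∀ r, {i | g i ≤ r}.Finite)
    (hfs : ∀ s, s₀ ≤ s → Summable fun i => f i ^ (-s))
    (hgs : ∀ s, s₀ ≤ s → Summable fun i => g i ^ (-s))
    (h : ∀ s, s₀ ≤ s → ∑' i, f i ^ (-s) = ∑' i, g i ^ (-s)) (r : ℝ) :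
    {i | f i = r}.ncard = {i | g i = r}.ncard := by
  have hff' : ∀ r, {i | f i = r}.Finite := fun r => (hff r).subset fun i hi => le_of_eq hi
  have hgf' : ∀ r, {i | g i = r}.Finite := fun r => (hgf r).subset fun i hi => le_of_eq hi
  by_contra hne
  -- At the least value `m` where the multiplicities differ, the terms below `m` cancel between the
  -- two series. Dividing the rest by `m ^ (-s)` and letting `s → ∞` leaves the two multiplicities
  -- of `m`, a contradiction.
  let D : Set ℝ := {r | {i | f i = r}.ncard ≠ {i | g i = r}.ncard}
  have hDfin : (D ∩ Set.Iic r).Finite := by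
    refine (((hff r).image f).union ((hgf r).image g)).subset ?_
    rintro x ⟨hx, hxr⟩
    by_contra hcon
    simp only [Set.mem_union, Set.mem_image, Set.mem_ofPred_eq, not_or, not_exists, not_and] at hcon
    apply hx
    have h1 : {i | f i = x} = ∅ := by
      ext i; simp only [Set.mem_ofPred_eq, Set.mem_empty_iff_false, iff_false]
      exact fun hi => hcon.1 i (hi ▸ hxr) hi
    have h2 : {i | g i = x} = ∅ := by
      ext i; simp only [Set.mem_ofPred_eq, Set.mem_empty_iff_false, iff_false]
      exact fun hi => hcon.2 i (hi ▸ hxr) hi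
    rw [h1, h2]; simp
  obtain ⟨m, ⟨hmD, hmr⟩, hmin⟩ := Set.exists_min_image _ id hDfin ⟨r, hne, le_refl r⟩
  have hlt : ∀ x, x < m → {i | f i = x}.ncard = {i | g i = x}.ncard := by
    intro x hx
    by_contra hxD
    exact absurd (hmin x ⟨hxD, hx.le.trans hmr⟩) (not_le.2 hx)
  have hm : 0 < m := by
    by_contra hm
    apply hmD
    have h1 : {i | f i = m} = ∅ := by
      ext i; simp only [Set.mem_ofPred_eq, Set.mem_empty_iff_false, iff_false]
      exact fun hi => hm (hi ▸ hf i)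
    have h2 : {i | g i = m} = ∅ := by
      ext i; simp only [Set.mem_ofPred_eq, Set.mem_empty_iff_false, iff_false]
      exact fun hi => hm (hi ▸ hg i)
    rw [h1, h2]; simp
  obtain ⟨e, he⟩ := exists_equiv_of_card_fiber_eq hff' hgf' (P := fun x => x < m) hlt
  have hrest : ∀ s, s₀ ≤ s → ∑' i : {i // ¬ f i < m}, (f i / m) ^ (-s) =
      ∑' i : {i // ¬ g i < m}, (g i / m) ^ (-s) := by
    intro s hss
    have hF := (hfs s hss).tsum_subtype_add_tsum_subtype_compl {i | f i < m}
    have hG := (hgs s hss).tsum_subtype_add_tsum_subtype_compl {i | g i < m}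
    have hlow : ∑' i : {i | f i < m}, f i ^ (-s) = ∑' i : {i | g i < m}, g i ^ (-s) := by
      refine (Equiv.tsum_eq e (fun i => g i ^ (-s))).symm.trans ?_ |>.symm
      exact tsum_congr fun i => by rw [he]
    have hhigh : ∑' i : {i // ¬ f i < m}, f i ^ (-s) = ∑' i : {i // ¬ g i < m}, g i ^ (-s) := by
      have := h s hss
      rw [← hF, ← hG, hlow] at this
      exact add_left_cancel this
    have hF' : ∀ i, (f i / m) ^ (-s) = f i ^ (-s) * (m ^ (-s))⁻¹ := fun i => by
      rw [Real.div_rpow (hf i).le hm.le, div_eq_mul_inv]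
    have hG' : ∀ i, (g i / m) ^ (-s) = g i ^ (-s) * (m ^ (-s))⁻¹ := fun i => by
      rw [Real.div_rpow (hg i).le hm.le, div_eq_mul_inv]
    simp_rw [hF', hG', tsum_mul_right, hhigh]
  have cardf : ({i : {i // ¬ f i < m} | f i = m}).ncard = {i | f i = m}.ncard := by
    rw [← Set.ncard_image_of_injective _ Subtype.val_injective]
    congr 1; ext i; simp only [Set.mem_image, Set.mem_ofPred_eq, Subtype.exists, exists_and_left,
      exists_prop, exists_eq_right_right]
    exact ⟨fun h => h.1, fun h => ⟨h, by simp [h]⟩⟩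
  have cardg : ({i : {i // ¬ g i < m} | g i = m}).ncard = {i | g i = m}.ncard := by
    rw [← Set.ncard_image_of_injective _ Subtype.val_injective]
    congr 1; ext i; simp only [Set.mem_image, Set.mem_ofPred_eq, Subtype.exists, exists_and_left,
      exists_prop, exists_eq_right_right]
    exact ⟨fun h => h.1, fun h => ⟨h, by simp [h]⟩⟩
  have t1 := tendsto_tsum_div_rpow (f := fun i : {i // ¬ f i < m} => f i) hm
    ((hff' m).preimage Subtype.val_injective.injOn) (fun i => not_lt.1 i.2)
    ((hfs s₀ le_rfl).subtype _)
  have t2 := tendsto_tsum_div_rpow (f := fun i : {i // ¬ g i < m} => g i) hm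
    ((hgf' m).preimage Subtype.val_injective.injOn) (fun i => not_lt.1 i.2)
    ((hgs s₀ le_rfl).subtype _)
  have := tendsto_nhds_unique (t1.congr' (by
    filter_upwards [eventually_ge_atTop s₀] with s hss using hrest s hss)) t2
  rw [cardf, cardg] at this
  exact hmD (by exact_mod_cast this)

end Dirichlet

open MeasureTheory Filter
open scoped Pointwise

/-! ### The Riemannian measure on the torus -/

section Volume

variable {n : ℕ} (Λ : Submodule ℤ (E n))

lemma proj_add (x y : E n) : proj Λ (x + y) = proj Λ x + proj Λ y := rfl

lemma proj_vadd (l : Λ) (x : E n) : proj Λ (l +ᵥ x) = proj Λ x := by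
  rw [eq_comm, proj_eq_iff]
  simp [Submodule.vadd_def]

variable [DiscreteTopology Λ]

lemma continuous_proj : Continuous (proj Λ) := (proj_isLocalHomeomorph Λ).continuous

lemma measurable_proj : Measurable (proj Λ) := (continuous_proj Λ).measurable

lemma exists_isOpen_injOn_proj (x : E n) :
    ∃ W : Set (E n), IsOpen W ∧ x ∈ W ∧ Set.InjOn (proj Λ) W := by
  obtain ⟨e, hx, he⟩ := proj_isLocalHomeomorph Λ x
  exact ⟨e.source, e.open_source, hx, by rw [he]; exact e.injOn⟩

instance : VAddInvariantMeasure Λ (E n) volume :=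
  inferInstanceAs (VAddInvariantMeasure Λ.toAddSubgroup (E n) volume)

variable [IsZLattice ℝ Λ]

/-- The fundamental parallelotope used in the definition of the volume. -/
def fundDomain : Set (E n) :=
  ZSpan.fundamentalDomain ((Module.Free.chooseBasis ℤ Λ).ofZLatticeBasis ℝ)

lemma isAddFundamentalDomain_fundDomain : IsAddFundamentalDomain Λ (fundDomain Λ) volume :=
  ZLattice.isAddFundamentalDomain _ _

lemma vol_apply {A : Set (Torus Λ)} (hA : MeasurableSet A) :
    vol Λ A = volume (proj Λ ⁻¹' A ∩ fundDomain Λ) := by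
  rw [vol, Measure.map_apply (measurable_proj Λ) hA,
    Measure.restrict_apply (measurable_proj Λ hA)]
  rfl

lemma vol_univ : vol Λ Set.univ = volume (fundDomain Λ) := by
  rw [vol_apply Λ MeasurableSet.univ, Set.preimage_univ, Set.univ_inter]

instance : IsFiniteMeasure (vol Λ) :=
  ⟨by rw [vol_univ]; exact (ZSpan.fundamentalDomain_isBounded _).measure_lt_top⟩

lemma vol_real_univ : (vol Λ).real Set.univ = ZLattice.covolume Λ := by
  rw [ZLattice.covolume_eq_measure_fundamentalDomain _ _ (isAddFundamentalDomain_fundDomain Λ),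
    measureReal_def, vol_univ, measureReal_def]

lemma vol_real_univ_pos : 0 < (vol Λ).real Set.univ := by
  rw [vol_real_univ]; exact ZLattice.covolume_pos _ _

instance : CompactSpace (Torus Λ) := by
  obtain ⟨r, hr⟩ := (ZSpan.fundamentalDomain_isBounded
    ((Module.Free.chooseBasis ℤ Λ).ofZLatticeBasis ℝ)).subset_closedBall 0
  refine ⟨?_⟩
  have hK := (isCompact_closedBall (0 : E n) r).image (continuous_proj Λ)
  convert hK
  refine (Set.eq_univ_of_forall fun p => ?_).symm
  obtain ⟨x, rfl⟩ := proj_surjective Λ p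
  obtain ⟨l, hl, -⟩ := ZSpan.exist_unique_vadd_mem_fundamentalDomain
    ((Module.Free.chooseBasis ℤ Λ).ofZLatticeBasis ℝ) x
  refine ⟨l +ᵥ x, hr hl, ?_⟩
  rw [eq_comm, proj_eq_iff]
  have hl' : (l : E n) ∈ Λ :=
    (Module.Basis.ofZLatticeBasis_span ℝ Λ (Module.Free.chooseBasis ℤ Λ)).le l.2
  simpa [Submodule.vadd_def] using hl'

/-- The projection is locally an isomorphism of measure spaces. -/
lemma vol_image_proj {B : Set (E n)} (hB : MeasurableSet B) (hi : Set.InjOn (proj Λ) B) :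
    vol Λ (proj Λ '' B) = volume B := by
  have hm : MeasurableSet (proj Λ '' B) :=
    hB.image_of_continuousOn_injOn (continuous_proj Λ).continuousOn hi
  have hpre : proj Λ ⁻¹' (proj Λ '' B) = ⋃ l : Λ, l +ᵥ B := by
    ext y
    simp only [Set.mem_preimage, Set.mem_image, Set.mem_iUnion, Set.mem_vadd_set]
    constructor
    · rintro ⟨x, hx, hxy⟩
      refine ⟨⟨y - x, proj_eq_iff.1 hxy⟩, x, hx, ?_⟩
      simp [Submodule.vadd_def]
    · rintro ⟨l, x, hx, rfl⟩
      exact ⟨x, hx, (proj_vadd Λ l x).symm⟩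
  -- Injectivity on `B` makes its translates disjoint, and the pieces they cut from the fundamental
  -- domain add up to the measure of `B`.
  rw [vol_apply Λ hm, hpre, Set.iUnion_inter, measure_iUnion₀,
    (isAddFundamentalDomain_fundDomain Λ).measure_eq_tsum B]
  · intro l m hlm
    refine Disjoint.aedisjoint ?_
    rw [Set.disjoint_left]
    rintro y ⟨⟨x, hx, rfl⟩, -⟩ ⟨⟨x', hx', h⟩, -⟩
    have hxx : x' = x := hi hx' hx (by
      rw [← proj_vadd Λ m x', ← proj_vadd Λ l x]
      exact congrArg _ h)
    subst hxx
    apply hlm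
    have h' : (m : E n) + x' = (l : E n) + x' := h
    exact Subtype.ext (add_right_cancel h').symm
  · intro l
    exact ((hB.const_vadd l).nullMeasurableSet).inter
      (isAddFundamentalDomain_fundDomain Λ).nullMeasurableSet

lemma map_proj_restrict {W : Set (E n)} (hW : MeasurableSet W) (hi : Set.InjOn (proj Λ) W) :
    Measure.map (proj Λ) (volume.restrict W) = (vol Λ).restrict (proj Λ '' W) := by
  ext A hA
  rw [Measure.map_apply (measurable_proj Λ) hA, Measure.restrict_apply (measurable_proj Λ hA),
    Measure.restrict_apply hA, ← vol_image_proj Λ ((measurable_proj Λ hA).inter hW)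
      (hi.mono Set.inter_subset_right), Set.image_preimage_inter]

/-- A translate of a fundamental domain is again one, and a `Λ`-periodic set meets all fundamental
domains in equal measure. -/
instance : (vol Λ).IsAddLeftInvariant := by
  refine ⟨fun p => ?_⟩
  obtain ⟨x, rfl⟩ := proj_surjective Λ p
  ext A hA
  have hm : Measurable (fun q : Torus Λ => proj Λ x + q) := (continuous_const_add _).measurable
  rw [Measure.map_apply hm hA, vol_apply Λ (hm hA), vol_apply Λ hA]
  have h1 : proj Λ ⁻¹' ((fun q : Torus Λ => proj Λ x + q) ⁻¹' A) ∩ fundDomain Λ =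
      (fun y => x + y) ⁻¹' (proj Λ ⁻¹' A ∩ (x +ᵥ fundDomain Λ)) := by
    ext y
    simp only [Set.mem_inter_iff, Set.mem_preimage, proj_add]
    rw [← vadd_eq_add x y, Set.vadd_mem_vadd_set_iff]
  rw [h1, measure_preimage_add]
  refine ((isAddFundamentalDomain_fundDomain Λ).vadd_of_comm x).measure_set_eq
    (isAddFundamentalDomain_fundDomain Λ) (measurable_proj Λ hA) fun l => ?_
  ext y
  simp only [Set.mem_preimage, proj_vadd]

instance : (vol Λ).IsOpenPosMeasure := by
  refine ⟨fun U hU ⟨p, hp⟩ h0 => ?_⟩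
  obtain ⟨x, rfl⟩ := proj_surjective Λ p
  obtain ⟨W, hW, hx, hi⟩ := exists_isOpen_injOn_proj Λ x
  have hV : IsOpen (proj Λ ⁻¹' U ∩ W) := (hU.preimage (continuous_proj Λ)).inter hW
  have := vol_image_proj Λ hV.measurableSet (hi.mono Set.inter_subset_right)
  rw [measure_mono_null _ h0] at this
  · exact (hV.measure_pos volume ⟨x, hp, hx⟩).ne this
  · rintro _ ⟨y, hy, rfl⟩
    exact hy.1

end Volume

/-! ### Jacobians and change of variables -/

section ChangeOfVariables

variable {n : ℕ}

/-- In the charts of the torus the projection is locally a translation. -/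
lemma hasMFDerivAt_proj (Λ : Submodule ℤ (E n)) [DiscreteTopology Λ] (x : E n) :
    HasMFDerivAt 𝓘(ℝ, E n) 𝓘(ℝ, E n) (proj Λ) x (ContinuousLinearMap.id ℝ (E n)) := by
  let c := chartAt (E n) (proj Λ x)
  have hc : c ∈ atlas (E n) (Torus Λ) := chart_mem_atlas _ _
  have hsrc : proj Λ x ∈ c.source := mem_chart_source _ _
  refine ⟨(continuous_proj Λ).continuousAt, ?_⟩
  simp only [mfld_simps]
  have hopen : IsOpen (proj Λ ⁻¹' c.source) := c.open_source.preimage (continuous_proj Λ)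
  have key := eventually_eq_add (Λ := Λ) (h := c ∘ proj Λ) hopen hsrc
    (c.continuousOn.comp (continuous_proj Λ).continuousOn (fun _ h => h)) (by
      intro y hy
      rw [← proj_eq_iff, Function.comp_apply, proj_chart_apply Λ hc hy])
  rw [chartAt_self_eq]
  exact (((hasFDerivAt_id (𝕜 := ℝ) x).add_const _).congr_of_eventuallyEq key).hasFDerivWithinAt

variable {Λ₁ Λ₂ : Submodule ℤ (E n)} [DiscreteTopology Λ₁] [DiscreteTopology Λ₂]

/-- A smooth map of tori has local lifts to `ℝⁿ`, whose derivative is that of the map. -/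
lemma exists_local_lift {φ : Torus Λ₁ → Torus Λ₂} (hφ : ContMDiff 𝓘(ℝ, E n) 𝓘(ℝ, E n) ∞ φ)
    (x : E n) : ∃ (W : Set (E n)) (ψ : E n → E n), IsOpen W ∧ x ∈ W ∧ Set.InjOn (proj Λ₁) W ∧
      ContDiffOn ℝ ∞ ψ W ∧ (∀ z ∈ W, proj Λ₂ (ψ z) = φ (proj Λ₁ z)) ∧
      ∀ z ∈ W, jacobian φ (proj Λ₁ z) = |(fderiv ℝ ψ z).det| := by
  obtain ⟨V, hV, hxV, hinj⟩ := exists_isOpen_injOn_proj Λ₁ x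
  let c := chartAt (E n) (φ (proj Λ₁ x))
  have hc : c ∈ atlas (E n) (Torus Λ₂) := chart_mem_atlas _ _
  have hcont : Continuous (φ ∘ proj Λ₁) := hφ.continuous.comp (continuous_proj Λ₁)
  have hO : IsOpen ((φ ∘ proj Λ₁) ⁻¹' c.source) := c.open_source.preimage hcont
  have hx : φ (proj Λ₁ x) ∈ c.source := mem_chart_source _ _
  let ψ : E n → E n := fun z => c (φ (proj Λ₁ z))
  have hlift : ∀ z ∈ (φ ∘ proj Λ₁) ⁻¹' c.source, proj Λ₂ (ψ z) = φ (proj Λ₁ z) :=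
    fun z hz => proj_chart_apply Λ₂ hc hz
  have hsm : ∀ z ∈ (φ ∘ proj Λ₁) ⁻¹' c.source, ContDiffAt ℝ ∞ ψ z := by
    intro z hz
    have h1 : ContMDiffAt 𝓘(ℝ, E n) 𝓘(ℝ, E n) ∞ c (φ (proj Λ₁ z)) :=
      contMDiffAt_of_mem_maximalAtlas
        (IsManifold.chart_mem_maximalAtlas (I := 𝓘(ℝ, E n)) (n := ∞) _) hz
    exact (h1.comp z ((hφ.comp (contMDiff_proj Λ₁)) z)).contDiffAt
  refine ⟨V ∩ (φ ∘ proj Λ₁) ⁻¹' c.source, ψ, hV.inter hO, ⟨hxV, hx⟩,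
    hinj.mono Set.inter_subset_left, fun z hz => (hsm z hz.2).contDiffWithinAt,
    fun z hz => hlift z hz.2, fun z hz => ?_⟩
  · have hd : HasFDerivAt ψ (fderiv ℝ ψ z) z :=
      ((hsm z hz.2).differentiableAt (by simp)).hasFDerivAt
    -- The map `φ ∘ proj Λ₁` is differentiated in two ways. Both projections have derivative the
    -- identity, so uniqueness identifies `mfderiv φ` with `fderiv ψ`.
    have h1 : HasMFDerivAt 𝓘(ℝ, E n) 𝓘(ℝ, E n) (proj Λ₂ ∘ ψ) z
        ((ContinuousLinearMap.id ℝ (E n)).comp (fderiv ℝ ψ z)) :=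
      (hasMFDerivAt_proj Λ₂ (ψ z)).comp z hd.hasMFDerivAt
    have h2 : HasMFDerivAt 𝓘(ℝ, E n) 𝓘(ℝ, E n) (φ ∘ proj Λ₁) z
        ((mfderiv 𝓘(ℝ, E n) 𝓘(ℝ, E n) φ (proj Λ₁ z)).comp (ContinuousLinearMap.id ℝ (E n))) :=
      ((hφ.mdifferentiable (by simp)) (proj Λ₁ z)).hasMFDerivAt.comp z (hasMFDerivAt_proj Λ₁ z)
    have h3 := h1.congr_of_eventuallyEq (f₁ := φ ∘ proj Λ₁)
      (by filter_upwards [hO.mem_nhds hz.2] with w hw using (hlift w hw).symm)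
    have h4 := hasMFDerivAt_unique h2 h3
    have h5 : (mfderiv 𝓘(ℝ, E n) 𝓘(ℝ, E n) φ (proj Λ₁ z) : E n →L[ℝ] E n) = fderiv ℝ ψ z := h4
    simp only [jacobian]
    rw [← h5]

/-- The preferred charts in `mfderiv` change with the point, so continuity is checked on `ℝⁿ`, where
a single smooth lift computes the jacobian on a whole neighbourhood. -/
lemma continuous_jacobian {φ : Torus Λ₁ → Torus Λ₂} (hφ : ContMDiff 𝓘(ℝ, E n) 𝓘(ℝ, E n) ∞ φ) :
    Continuous (jacobian φ) := by
  rw [(proj_isLocalHomeomorph Λ₁).isOpenMap.isQuotientMap (continuous_proj Λ₁)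
    (proj_surjective Λ₁) |>.continuous_iff, continuous_iff_continuousAt]
  intro x
  obtain ⟨W, ψ, hW, hx, -, hψ, -, hJ⟩ := exists_local_lift hφ x
  have h1 : ContinuousAt (fun z => |(fderiv ℝ ψ z).det|) x :=
    (ContinuousLinearMap.continuous_det.comp_continuousOn
      (hψ.continuousOn_fderiv_of_isOpen hW (by simp))).abs.continuousAt (hW.mem_nhds hx)
  refine h1.congr ?_
  filter_upwards [hW.mem_nhds hx] with z hz using (hJ z hz).symm

variable [IsZLattice ℝ Λ₁] [IsZLattice ℝ Λ₂]

/-- The change of variables formula for a diffeomorphism of flat tori. -/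
theorem map_withDensity_jacobian
    (φ : Diffeomorph 𝓘(ℝ, E n) 𝓘(ℝ, E n) (Torus Λ₁) (Torus Λ₂) ∞) :
    Measure.map φ ((vol Λ₁).withDensity fun p => ENNReal.ofReal (jacobian φ p)) = vol Λ₂ := by
  let e : Torus Λ₁ ≃ᵐ Torus Λ₂ := φ.toHomeomorph.toMeasurableEquiv
  have hjm : Measurable fun p => ENNReal.ofReal (jacobian φ p) :=
    (continuous_jacobian φ.contMDiff).measurable.ennreal_ofReal
  suffices h : (vol Λ₁).withDensity (fun p => ENNReal.ofReal (jacobian φ p)) =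
      Measure.map e.symm (vol Λ₂) by
    rw [h]
    exact e.map_map_symm
  choose W ψ hW hx hinj hψ hlift hJ using
    fun x => exists_local_lift (Λ₁ := Λ₁) (Λ₂ := Λ₂) φ.contMDiff x
  -- Countably many images of lift domains cover the torus, so it suffices to compare the measures
  -- on each, where the Euclidean formula applies to the lift.
  obtain ⟨s, hs, hsU⟩ := TopologicalSpace.countable_cover_nhds
    (f := fun p : Torus Λ₁ => proj Λ₁ '' W (proj_surjective Λ₁ p).choose) (fun p => by
      have := ((proj_isLocalHomeomorph Λ₁).isOpenMap _ (hW (proj_surjective Λ₁ p).choose)).mem_nhds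
        ⟨_, hx _, (proj_surjective Λ₁ p).choose_spec⟩
      exact this)
  have := hs.to_subtype
  rw [Measure.ext_iff_of_iUnion_eq_univ (s := fun p : s =>
    proj Λ₁ '' W (proj_surjective Λ₁ p).choose) (by rw [← hsU, Set.biUnion_eq_iUnion])]
  rintro ⟨p, -⟩
  generalize (proj_surjective Λ₁ p).choose = x
  have hWm : MeasurableSet (proj Λ₁ '' W x) :=
    ((proj_isLocalHomeomorph Λ₁).isOpenMap _ (hW x)).measurableSet
  ext A hA
  have hB : MeasurableSet (W x ∩ proj Λ₁ ⁻¹' A) :=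
    (hW x).measurableSet.inter (measurable_proj Λ₁ hA)
  have hψi : Set.InjOn (proj Λ₂ ∘ ψ x) (W x ∩ proj Λ₁ ⁻¹' A) := by
    intro y hy z hz h
    simp only [Function.comp_apply, hlift x y hy.1, hlift x z hz.1] at h
    exact hinj x hy.1 hz.1 (φ.injective h)
  have hψd : ∀ z ∈ W x ∩ proj Λ₁ ⁻¹' A,
      HasFDerivWithinAt (ψ x) (fderiv ℝ (ψ x) z) (W x ∩ proj Λ₁ ⁻¹' A) z := fun z hz =>
    (((hψ x).contDiffAt ((hW x).mem_nhds hz.1)).differentiableAt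
      (by simp)).hasFDerivAt.hasFDerivWithinAt
  have hmψ : MeasurableSet (ψ x '' (W x ∩ proj Λ₁ ⁻¹' A)) :=
    measurable_image_of_fderivWithin hB hψd hψi.of_comp
  have himg : e.symm ⁻¹' (A ∩ proj Λ₁ '' W x) = proj Λ₂ '' (ψ x '' (W x ∩ proj Λ₁ ⁻¹' A)) := by
    rw [← e.image_eq_preimage_symm, Set.inter_comm A, ← Set.image_inter_preimage, Set.image_image,
      Set.image_image]
    exact Set.image_congr fun z hz => (hlift x z hz.1).symm
  rw [Measure.restrict_apply hA, Measure.restrict_apply hA,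
    Measure.map_apply e.symm.measurable (hA.inter hWm), himg, vol_image_proj Λ₂ hmψ
      (by rintro _ ⟨y, hy, rfl⟩ _ ⟨z, hz, rfl⟩ h; exact congrArg _ (hψi hy hz h)),
    ← lintegral_abs_det_fderiv_eq_addHaar_image volume hB hψd hψi.of_comp,
    withDensity_apply _ (hA.inter hWm), ← Measure.restrict_restrict hA,
    ← map_proj_restrict Λ₁ (hW x).measurableSet (hinj x),
    setLIntegral_map hA hjm (measurable_proj Λ₁), Measure.restrict_restrict (measurable_proj Λ₁ hA),
    Set.inter_comm]
  exact setLIntegral_congr_fun hB fun z hz => by rw [hJ x z hz.1]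

theorem integral_comp_mul_jacobian
    (φ : Diffeomorph 𝓘(ℝ, E n) 𝓘(ℝ, E n) (Torus Λ₁) (Torus Λ₂) ∞) (g : Torus Λ₂ → ℝ) :
    ∫ q, g q ∂(vol Λ₂) = ∫ p, jacobian φ p * g (φ p) ∂(vol Λ₁) := by
  let e : Torus Λ₁ ≃ᵐ Torus Λ₂ := φ.toHomeomorph.toMeasurableEquiv
  have h := integral_map_equiv
    (μ := (vol Λ₁).withDensity fun p => ENNReal.ofReal (jacobian φ p)) e g
  rw [← map_withDensity_jacobian φ]
  refine h.trans ?_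
  rw [integral_withDensity_eq_integral_toReal_smul
    (continuous_jacobian φ.contMDiff).measurable.ennreal_ofReal (by simp)]
  refine integral_congr_ae (Eventually.of_forall fun p => ?_)
  simp only [smul_eq_mul]
  rw [ENNReal.toReal_ofReal (by simp [jacobian])]
  rfl

end ChangeOfVariables

open MeasureTheory Filter Complex
open scoped Pointwise ComplexConjugate

/-! ### Characters and the Fourier basis -/

section Characters

variable {n : ℕ} {Λ : Submodule ℤ (E n)}

lemma proj_out (p : Torus Λ) : proj Λ (Quotient.out p) = p := Quotient.out_eq p

/-- The exponential function `x ↦ exp (2πi⟨ξ, x⟩)` on `ℝⁿ`. -/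
def expInner (ξ x : E n) : ℂ := cexp (((2 * Real.pi * inner ℝ ξ x : ℝ) : ℂ) * I)

lemma expInner_add (ξ x y : E n) : expInner ξ (x + y) = expInner ξ x * expInner ξ y := by
  simp only [expInner, inner_add_right, mul_add, ofReal_add, add_mul, Complex.exp_add]

lemma expInner_add_left (ξ η x : E n) : expInner (ξ + η) x = expInner ξ x * expInner η x := by
  simp only [expInner, inner_add_left, mul_add, ofReal_add, add_mul, Complex.exp_add]

lemma expInner_neg_left (ξ x : E n) : expInner (-ξ) x = conj (expInner ξ x) := by
  rw [expInner, expInner, ← Complex.exp_conj, map_mul, conj_ofReal, conj_I, inner_neg_left]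
  push_cast
  ring_nf

lemma expInner_zero_left (x : E n) : expInner 0 x = 1 := by simp [expInner]

lemma norm_expInner (ξ x : E n) : ‖expInner ξ x‖ = 1 := Complex.norm_exp_ofReal_mul_I _

lemma expInner_eq_one_iff (ξ x : E n) : expInner ξ x = 1 ↔ ∃ k : ℤ, inner ℝ ξ x = k := by
  rw [expInner, Complex.exp_eq_one_iff]
  refine exists_congr fun k => ?_
  rw [← mul_assoc, mul_left_inj' I_ne_zero, mul_comm (k : ℂ)]
  constructor
  · intro h
    have h' : 2 * Real.pi * inner ℝ ξ x = 2 * Real.pi * k := by exact_mod_cast h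
    exact mul_left_cancel₀ (by positivity) h'
  · intro h
    rw [h]
    push_cast
    ring

lemma hasFDerivAt_expInner (ξ x : E n) : HasFDerivAt (expInner ξ)
    ((expInner ξ x * (2 * Real.pi * I)) • (ofRealCLM ∘L innerSL ℝ ξ)) x := by
  have h1 : HasFDerivAt (fun y : E n => ((inner ℝ ξ y : ℝ) : ℂ)) (ofRealCLM ∘L innerSL ℝ ξ) x :=
    (ofRealCLM ∘L innerSL ℝ ξ).hasFDerivAt
  have h2 := (h1.const_mul (2 * Real.pi * I : ℂ)).cexp
  rw [smul_smul] at h2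
  have : expInner ξ = fun y => cexp (2 * Real.pi * I * ((inner ℝ ξ y : ℝ) : ℂ)) := by
    ext y; rw [expInner]; push_cast; ring_nf
  rw [this]
  exact h2

lemma contDiff_expInner (ξ : E n) : ContDiff ℝ ∞ (expInner ξ) := by
  unfold expInner
  have h : ContDiff ℝ ∞ fun x : E n => 2 * Real.pi * inner ℝ ξ x :=
    contDiff_const.mul (contDiff_const.inner ℝ contDiff_id)
  exact ((ofRealCLM.contDiff.comp h).mul contDiff_const).cexp

/-- The character of the torus given by an element of the dual lattice. -/
def char (ξ : dual Λ) (p : Torus Λ) : ℂ := expInner ξ (Quotient.out p)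

/-- The function on the torus induced by a function on `ℝⁿ`. -/
def descend {F : Type*} (f : E n → F) (p : Torus Λ) : F := f (Quotient.out p)

lemma descend_comp_proj {F : Type*} {f : E n → F} (hf : ∀ l ∈ Λ, ∀ x, f (x + l) = f x) :
    (descend f : Torus Λ → F) ∘ proj Λ = f := by
  funext x
  have h : Quotient.out (proj Λ x) - x ∈ Λ := proj_eq_iff.1 (proj_out (proj Λ x)).symm
  have := hf _ h x
  rwa [add_sub_cancel] at this

lemma char_comp_proj (ξ : dual Λ) : char ξ ∘ proj Λ = expInner ξ := by
  refine descend_comp_proj (f := expInner (ξ : E n)) fun l hl x => ?_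
  rw [expInner_add, (expInner_eq_one_iff _ _).2 (mem_dual.1 ξ.2 l hl), mul_one]

lemma char_proj (ξ : dual Λ) (x : E n) : char ξ (proj Λ x) = expInner ξ x :=
  congrFun (char_comp_proj ξ) x

lemma char_add_right (ξ : dual Λ) (p q : Torus Λ) : char ξ (p + q) = char ξ p * char ξ q := by
  obtain ⟨x, rfl⟩ := proj_surjective Λ p
  obtain ⟨y, rfl⟩ := proj_surjective Λ q
  rw [← proj_add, char_proj, char_proj, char_proj, expInner_add]

lemma char_add_left (ξ η : dual Λ) (p : Torus Λ) : char (ξ + η) p = char ξ p * char η p :=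
  expInner_add_left _ _ _

lemma char_neg_left (ξ : dual Λ) (p : Torus Λ) : char (-ξ) p = conj (char ξ p) :=
  expInner_neg_left _ _

lemma char_zero_left (p : Torus Λ) : char 0 p = 1 := expInner_zero_left _

lemma norm_char (ξ : dual Λ) (p : Torus Λ) : ‖char ξ p‖ = 1 := norm_expInner _ _

lemma conj_char_mul_char (ξ : dual Λ) (p : Torus Λ) : conj (char ξ p) * char ξ p = 1 := by
  rw [← char_neg_left, ← char_add_left, neg_add_cancel, char_zero_left]

variable [DiscreteTopology Λ]

/-- A chart is a local section of the projection, so `f` is locally its periodic lift composed with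
a chart. -/
lemma contMDiff_of_comp_proj {F : Type*} [NormedAddCommGroup F] [NormedSpace ℝ F]
    {f : Torus Λ → F} (hf : ContDiff ℝ ∞ (f ∘ proj Λ)) : ContMDiff 𝓘(ℝ, E n) 𝓘(ℝ, F) ∞ f := by
  intro p
  let c := chartAt (E n) p
  have h1 : ContMDiffAt 𝓘(ℝ, E n) 𝓘(ℝ, E n) ∞ c p :=
    contMDiffAt_of_mem_maximalAtlas
      (IsManifold.chart_mem_maximalAtlas (I := 𝓘(ℝ, E n)) (n := ∞) _) (mem_chart_source _ _)
  refine (hf.contMDiff.contMDiffAt.comp p h1).congr_of_eventuallyEq ?_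
  filter_upwards [c.open_source.mem_nhds (mem_chart_source _ p)] with q hq
  simp only [Function.comp_apply]
  rw [proj_chart_apply Λ (chart_mem_atlas _ _) hq]

lemma contDiff_comp_proj {F : Type*} [NormedAddCommGroup F] [NormedSpace ℝ F]
    {f : Torus Λ → F} (hf : ContMDiff 𝓘(ℝ, E n) 𝓘(ℝ, F) ∞ f) : ContDiff ℝ ∞ (f ∘ proj Λ) :=
  (hf.comp (contMDiff_proj Λ)).contDiff

lemma contMDiff_char (ξ : dual Λ) : ContMDiff 𝓘(ℝ, E n) 𝓘(ℝ, ℂ) ∞ (char ξ) :=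
  contMDiff_of_comp_proj (by rw [char_comp_proj]; exact contDiff_expInner _)

/-- The characters as continuous functions. -/
def charC (ξ : dual Λ) : C(Torus Λ, ℂ) := ⟨char ξ, (contMDiff_char ξ).continuous⟩

/-- The star subalgebra generated by the characters. -/
def charSubalgebra (Λ : Submodule ℤ (E n)) [DiscreteTopology Λ] :
    StarSubalgebra ℂ C(Torus Λ, ℂ) where
  toSubalgebra := Algebra.adjoin ℂ (Set.range charC)
  star_mem' := by
    change Algebra.adjoin ℂ (Set.range charC) ≤ star (Algebra.adjoin ℂ (Set.range charC))
    refine Algebra.adjoin_le ?_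
    rintro _ ⟨ξ, rfl⟩
    refine Algebra.subset_adjoin ⟨-ξ, ?_⟩
    ext p
    exact char_neg_left ξ p

/-- Characters are closed under products and include 1, so Stone–Weierstrass for the generated
algebra becomes density of their linear span. -/
lemma charSubalgebra_coe : (charSubalgebra Λ).toSubalgebra.toSubmodule =
    Submodule.span ℂ (Set.range charC) := by
  apply Algebra.adjoin_eq_span_of_subset
  refine .trans (fun x => Submonoid.closure_induction (fun _ => id) ⟨0, ?_⟩ ?_)
    Submodule.subset_span
  · ext p
    exact char_zero_left p
  · rintro _ _ _ _ ⟨ξ, rfl⟩ ⟨η, rfl⟩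
    refine ⟨ξ + η, ?_⟩
    ext p
    exact char_add_left ξ η p

variable [IsZLattice ℝ Λ]

lemma charSubalgebra_separatesPoints : (charSubalgebra Λ).SeparatesPoints := by
  intro p q hpq
  obtain ⟨x, rfl⟩ := proj_surjective Λ p
  obtain ⟨y, rfl⟩ := proj_surjective Λ q
  by_contra! h
  apply hpq
  rw [proj_eq_iff]
  refine mem_of_inner_dual Λ fun ξ hξ => ?_
  have h1 : char ⟨ξ, hξ⟩ (proj Λ x) = char ⟨ξ, hξ⟩ (proj Λ y) :=
    h _ ⟨charC ⟨ξ, hξ⟩, Algebra.subset_adjoin ⟨⟨ξ, hξ⟩, rfl⟩, rfl⟩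
  rw [char_proj, char_proj] at h1
  rw [← expInner_eq_one_iff]
  have h2 : expInner ξ (y - x) * expInner ξ x = expInner ξ y := by
    rw [← expInner_add, sub_add_cancel]
  have h3 : expInner ξ x ≠ 0 := by
    rw [← norm_ne_zero_iff, norm_expInner]; exact one_ne_zero
  have h1' : expInner ξ x = expInner ξ y := h1
  rw [← h1'] at h2
  exact mul_eq_right₀ h3 |>.1 h2

lemma span_charC_closure_eq_top :
    (Submodule.span ℂ (Set.range (charC (Λ := Λ)))).topologicalClosure = ⊤ := by
  rw [← charSubalgebra_coe]
  exact congr_arg (Subalgebra.toSubmodule <| StarSubalgebra.toSubalgebra ·)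
    (ContinuousMap.starSubalgebra_topologicalClosure_eq_top_of_separatesPoints _
      charSubalgebra_separatesPoints)

lemma integral_char {ξ : dual Λ} (hξ : ξ ≠ 0) : ∫ p, char ξ p ∂(vol Λ) = 0 := by
  have h0 : inner ℝ (ξ : E n) (ξ : E n) ≠ 0 := by
    rw [ne_eq, inner_self_eq_zero]
    simpa using hξ
  -- Chosen so that `⟨ξ, x⟩ = 1/2`, which is not an integer. Translation by `x` multiplies the
  -- integral by a number other than 1 but preserves it.
  let x : E n := (2 * inner ℝ (ξ : E n) (ξ : E n))⁻¹ • (ξ : E n)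
  have hx : char ξ (proj Λ x) ≠ 1 := by
    rw [char_proj, ne_eq, expInner_eq_one_iff]
    rintro ⟨k, hk⟩
    rw [inner_smul_right] at hk
    have : (2 * k : ℝ) = 1 := by rw [← hk]; field_simp
    have h' : (2 * k : ℤ) = 1 := by exact_mod_cast this
    omega
  have h := integral_add_left_eq_self (μ := vol Λ) (char ξ) (proj Λ x)
  simp_rw [char_add_right, integral_const_mul] at h
  by_contra hne
  exact hx (mul_eq_right₀ hne |>.1 h)

/-- Needed for the density of continuous functions in `L²`. -/
instance : (vol Λ).WeaklyRegular := by
  have := TopologicalSpace.metrizableSpace_of_t3_secondCountable (Torus Λ)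
  infer_instance

/-- The characters, normalized in `L²`. -/
def charLp (ξ : dual Λ) : L2 Λ :=
  (((Real.sqrt ((vol Λ).real Set.univ))⁻¹ : ℝ) : ℂ) • ContinuousMap.toLp 2 (vol Λ) ℂ (charC ξ)

lemma charLp_ae (ξ : dual Λ) : charLp ξ =ᵐ[vol Λ]
    fun p => (((Real.sqrt ((vol Λ).real Set.univ))⁻¹ : ℝ) : ℂ) * char ξ p := by
  filter_upwards [Lp.coeFn_smul (((Real.sqrt ((vol Λ).real Set.univ))⁻¹ : ℝ) : ℂ)
    (ContinuousMap.toLp 2 (vol Λ) ℂ (charC ξ)),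
    ContinuousMap.coeFn_toLp (p := 2) (𝕜 := ℂ) (vol Λ) (charC ξ)]
    with p h1 h2
  rw [charLp, h1, Pi.smul_apply, h2]
  rfl

lemma inv_sqrt_vol_mul_self : (((Real.sqrt ((vol Λ).real Set.univ))⁻¹ : ℝ) : ℂ) *
    (((Real.sqrt ((vol Λ).real Set.univ))⁻¹ : ℝ) : ℂ) = (((vol Λ).real Set.univ : ℝ) : ℂ)⁻¹ := by
  rw [← ofReal_mul, ← mul_inv, Real.mul_self_sqrt (vol_real_univ_pos Λ).le, ofReal_inv]

lemma orthonormal_charLp : Orthonormal ℂ (charLp (Λ := Λ)) := by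
  rw [orthonormal_iff_ite]
  intro ξ η
  rw [charLp, charLp, inner_smul_left, inner_smul_right, conj_ofReal, ← mul_assoc,
    inv_sqrt_vol_mul_self, ContinuousMap.inner_toLp]
  have h : ∀ p, charC η p * conj (charC ξ p) = char (η - ξ) p := fun p => by
    rw [sub_eq_add_neg, char_add_left, char_neg_left]; rfl
  simp_rw [h]
  split_ifs with hξ
  · subst hξ
    simp only [sub_self, char_zero_left, integral_const]
    have := (vol_real_univ_pos Λ).ne'
    simp [this]
  · rw [integral_char (sub_ne_zero.2 (Ne.symm hξ)), mul_zero]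

lemma span_charLp_closure_eq_top :
    (Submodule.span ℂ (Set.range (charLp (Λ := Λ)))).topologicalClosure = ⊤ := by
  have h1 : (Submodule.span ℂ (Set.range fun ξ : dual Λ =>
      ContinuousMap.toLp 2 (vol Λ) ℂ (charC ξ))).topologicalClosure = ⊤ := by
    simpa only [Submodule.map_span, ContinuousLinearMap.coe_coe, ← Set.range_comp,
      Function.comp_def] using
      (ContinuousMap.toLp_denseRange ℂ (vol Λ) ℂ (p := 2)
        (by simp)).topologicalClosure_map_submodule span_charC_closure_eq_top
  rw [← top_le_iff, ← h1]
  refine Submodule.topologicalClosure_mono (Submodule.span_le.2 ?_)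
  rintro _ ⟨ξ, rfl⟩
  have h0 : (((Real.sqrt ((vol Λ).real Set.univ))⁻¹ : ℝ) : ℂ) ≠ 0 := by
    rw [ofReal_ne_zero]
    exact inv_ne_zero (Real.sqrt_ne_zero'.2 (vol_real_univ_pos Λ))
  have h2 : charLp ξ ∈ Submodule.span ℂ (Set.range (charLp (Λ := Λ))) :=
    Submodule.subset_span ⟨ξ, rfl⟩
  exact (Submodule.smul_mem_iff _ h0).1 h2

/-- The Hilbert basis of `L²(T)` consisting of the normalized characters. -/
def charBasis (Λ : Submodule ℤ (E n)) [DiscreteTopology Λ] [IsZLattice ℝ Λ] :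
    HilbertBasis (dual Λ) ℂ (L2 Λ) :=
  HilbertBasis.mk orthonormal_charLp span_charLp_closure_eq_top.ge

lemma coe_charBasis : ⇑(charBasis Λ) = charLp := HilbertBasis.coe_mk _ _

end Characters

/-! ### Eigenspaces of the Laplacian -/

section Eigenspaces

variable {n : ℕ} {Λ : Submodule ℤ (E n)}

lemma comp_proj_add {F : Type*} (f : Torus Λ → F) {l : E n} (hl : l ∈ Λ) (x : E n) :
    (f ∘ proj Λ) (x + l) = (f ∘ proj Λ) x := by
  have : proj Λ x = proj Λ (x + l) := proj_eq_iff.2 (by simpa using hl)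
  simp [this]

/-- The eigenvalue of the Laplace operator on the character of an element of the dual lattice. -/
def lam (ξ : dual Λ) : ℝ := 4 * Real.pi ^ 2 * ‖ξ‖ ^ 2

lemma sum_sq_inner (ξ : dual Λ) : ∑ i, (2 * Real.pi * I *
    (inner ℝ (ξ : E n) (EuclideanSpace.basisFun (Fin n) ℝ i) : ℝ) : ℂ) ^ 2 = -(lam ξ : ℂ) := by
  have h := (EuclideanSpace.basisFun (Fin n) ℝ).sum_sq_norm_inner_left (ξ : E n)
  simp only [mul_pow, I_sq, lam, ← Finset.mul_sum]
  rw [Submodule.coe_norm, ← h]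
  push_cast
  simp only [Real.norm_eq_abs, ← ofReal_pow, sq_abs]
  ring

/-- The derivative of a function on the torus in the direction of a vector. -/
def dirDeriv (v : E n) (f : Torus Λ → ℂ) : Torus Λ → ℂ :=
  descend fun x => fderiv ℝ (f ∘ proj Λ) x v

lemma dirDeriv_comp_proj (v : E n) (f : Torus Λ → ℂ) :
    dirDeriv v f ∘ proj Λ = fun x => fderiv ℝ (f ∘ proj Λ) x v := by
  refine descend_comp_proj fun l hl x => ?_
  rw [← fderiv_comp_add_right l]
  congr 2
  funext y
  exact comp_proj_add f hl y

lemma fderiv_expInner (ξ x v : E n) : fderiv ℝ (expInner ξ) x v =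
    2 * Real.pi * I * inner ℝ ξ v * expInner ξ x := by
  rw [(hasFDerivAt_expInner ξ x).fderiv]
  simp
  ring

lemma dirDeriv_const_mul_char (v : E n) (c : ℂ) (ξ : dual Λ) :
    dirDeriv v (fun p => c * char ξ p) =
      fun p => (2 * Real.pi * I * inner ℝ (ξ : E n) v) * c * char ξ p := by
  funext p
  obtain ⟨x, rfl⟩ := proj_surjective Λ p
  have h := congrFun (dirDeriv_comp_proj v (fun p => c * char ξ p)) x
  simp only [Function.comp_apply] at h
  have h2 : ((fun p => c * char ξ p) ∘ proj Λ) = fun y => c * expInner (ξ : E n) y := by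
    funext y
    simp [char_proj]
  rw [h, h2, fderiv_const_mul (hasFDerivAt_expInner _ _).differentiableAt, char_proj]
  simp only [_root_.smul_apply, fderiv_expInner, smul_eq_mul]
  ring

lemma proj_zero : proj Λ 0 = 0 := rfl

variable [DiscreteTopology Λ]

lemma contMDiff_dirDeriv (v : E n) {f : Torus Λ → ℂ} (hf : ContMDiff 𝓘(ℝ, E n) 𝓘(ℝ, ℂ) ∞ f) :
    ContMDiff 𝓘(ℝ, E n) 𝓘(ℝ, ℂ) ∞ (dirDeriv v f) := by
  refine contMDiff_of_comp_proj ?_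
  rw [dirDeriv_comp_proj]
  exact ((contDiff_comp_proj hf).fderiv_right (m := ∞) (by simp)).clm_apply contDiff_const

/-- First-order operators on the torus itself let Fourier coefficients be computed one derivative at
a time. -/
lemma laplaceBeltrami_eq_sum {f : Torus Λ → ℂ} (hf : ContMDiff 𝓘(ℝ, E n) 𝓘(ℝ, ℂ) ∞ f)
    (p : Torus Λ) : laplaceBeltrami Λ f p = -∑ i, dirDeriv (EuclideanSpace.basisFun (Fin n) ℝ i)
      (dirDeriv (EuclideanSpace.basisFun (Fin n) ℝ i) f) p := by
  rw [laplaceBeltrami, InnerProductSpace.laplacian_eq_iteratedFDeriv_orthonormalBasis _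
    (EuclideanSpace.basisFun (Fin n) ℝ)]
  refine congrArg _ (Finset.sum_congr rfl fun i _ => ?_)
  have hd : Differentiable ℝ (fderiv ℝ (f ∘ proj Λ)) :=
    ((contDiff_comp_proj hf).fderiv_right (m := ∞) (by simp)).differentiable (by simp)
  rw [iteratedFDeriv_two_apply, dirDeriv, descend, dirDeriv_comp_proj,
    fderiv_clm_apply (hd _) (differentiableAt_const _)]
  simp

lemma contMDiff_const_mul_char (c : ℂ) (ξ : dual Λ) :
    ContMDiff 𝓘(ℝ, E n) 𝓘(ℝ, ℂ) ∞ fun p => c * char ξ p :=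
  contMDiff_of_comp_proj (contDiff_const.mul (contDiff_comp_proj (contMDiff_char ξ)))

lemma laplaceBeltrami_char (ξ : dual Λ) (c : ℂ) (p : Torus Λ) :
    laplaceBeltrami Λ (fun p => c * char ξ p) p = (lam ξ : ℂ) * (c * char ξ p) := by
  rw [laplaceBeltrami_eq_sum (contMDiff_const_mul_char c ξ)]
  simp only [dirDeriv_const_mul_char]
  rw [← neg_neg (lam ξ : ℂ), ← sum_sq_inner, neg_mul, Finset.sum_mul]
  congr 1
  exact Finset.sum_congr rfl fun i _ => by ring

lemma dirDeriv_hasDerivAt {f : Torus Λ → ℂ} (hf : ContMDiff 𝓘(ℝ, E n) 𝓘(ℝ, ℂ) ∞ f) (v : E n)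
    (p : Torus Λ) (t : ℝ) : HasDerivAt (fun t : ℝ => f (proj Λ (t • v) + p))
      (dirDeriv v f (proj Λ (t • v) + p)) t := by
  obtain ⟨x, rfl⟩ := proj_surjective Λ p
  rw [← proj_add]
  have h := congrFun (dirDeriv_comp_proj v f) (t • v + x)
  simp only [Function.comp_apply] at h
  rw [h]
  have h1 : HasFDerivAt (f ∘ proj Λ) (fderiv ℝ (f ∘ proj Λ) (t • v + x)) (t • v + x) :=
    ((contDiff_comp_proj hf).differentiable (by simp) _).hasFDerivAt
  have h2 : HasDerivAt (fun t : ℝ => t • v + x) v t := by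
    simpa using ((hasDerivAt_id t).smul_const v).add_const x
  exact h1.comp_hasDerivAt t h2

lemma continuous_char (ξ : dual Λ) : Continuous (char ξ) := (contMDiff_char ξ).continuous

variable [IsZLattice ℝ Λ]

lemma integrable_of_continuous {F : Type*} [NormedAddCommGroup F] {f : Torus Λ → F}
    (hf : Continuous f) : Integrable f (vol Λ) :=
  hf.integrable_of_hasCompactSupport (HasCompactSupport.of_compactSpace f)

/-- Differentiation acts on Fourier coefficients by multiplication. -/
lemma integral_conj_char_mul_dirDeriv (ξ : dual Λ) (v : E n) {f : Torus Λ → ℂ}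
    (hf : ContMDiff 𝓘(ℝ, E n) 𝓘(ℝ, ℂ) ∞ f) :
    ∫ p, conj (char ξ p) * dirDeriv v f p ∂(vol Λ) =
      2 * Real.pi * I * inner ℝ (ξ : E n) v * ∫ p, conj (char ξ p) * f p ∂(vol Λ) := by
  have hcc : Continuous fun p => conj (char ξ p) := continuous_conj.comp (continuous_char ξ)
  have hfc : Continuous f := hf.continuous
  have hdc : Continuous (dirDeriv v f) := (contMDiff_dirDeriv v hf).continuous
  obtain ⟨C, hC⟩ := (isCompact_range hdc).isBounded.exists_norm_le
  -- In place of integration by parts, the integral of `conj χ` times the translate of `f` by `t •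
  -- v` is differentiated at `t = 0`: under the integral sign here, and through translation
  -- invariance in `h2`.
  have h1 := (hasDerivAt_integral_of_dominated_loc_of_deriv_le (μ := vol Λ) (x₀ := (0 : ℝ))
    (s := Set.univ) (bound := fun _ => C)
    (F := fun (t : ℝ) p => conj (char ξ p) * f (proj Λ (t • v) + p))
    (F' := fun (t : ℝ) p => conj (char ξ p) * dirDeriv v f (proj Λ (t • v) + p))
    univ_mem (Eventually.of_forall fun t => Continuous.aestronglyMeasurable (by fun_prop))
    (integrable_of_continuous (by fun_prop)) (Continuous.aestronglyMeasurable (by fun_prop))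
    (Eventually.of_forall fun p t _ => by
      rw [norm_mul, RCLike.norm_conj, norm_char, one_mul]
      exact hC _ ⟨_, rfl⟩) (integrable_const _)
    (Eventually.of_forall fun p t _ => (dirDeriv_hasDerivAt hf v p t).const_mul _)).2
  have h2 : (fun t : ℝ => ∫ p, conj (char ξ p) * f (proj Λ (t • v) + p) ∂(vol Λ)) =
      fun t : ℝ => expInner (ξ : E n) (t • v) * ∫ p, conj (char ξ p) * f p ∂(vol Λ) := by
    funext t
    rw [← integral_add_left_eq_self (μ := vol Λ) (fun p => conj (char ξ p) * f p) (proj Λ (t • v)),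
      ← integral_const_mul]
    refine integral_congr_ae (Eventually.of_forall fun p => ?_)
    simp only [char_add_right, map_mul]
    rw [← char_proj]
    have := conj_char_mul_char ξ (proj Λ (t • v))
    linear_combination (-(conj (char ξ p) * f (proj Λ (t • v) + p))) * this
  rw [h2] at h1
  have h3 : HasDerivAt (fun t : ℝ => expInner (ξ : E n) (t • v))
      (2 * Real.pi * I * inner ℝ (ξ : E n) v) 0 := by
    have h4 : HasDerivAt (fun t : ℝ => t • v) v 0 := by
      simpa using (hasDerivAt_id (0 : ℝ)).smul_const v
    have h5 := (hasFDerivAt_expInner (ξ : E n) ((0 : ℝ) • v)).comp_hasDerivAt 0 h4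
    have h6 : (2 * Real.pi * I * inner ℝ (ξ : E n) v : ℂ) = ((expInner (ξ : E n) ((0 : ℝ) • v) *
        (2 * Real.pi * I)) • (ofRealCLM ∘L innerSL ℝ (ξ : E n))) v := by
      simp [expInner]
    rw [h6]
    exact h5
  have h6 := h1.unique (h3.mul_const _)
  simpa [proj_zero] using h6

lemma integral_conj_char_mul_laplaceBeltrami (ξ : dual Λ) {f : Torus Λ → ℂ}
    (hf : ContMDiff 𝓘(ℝ, E n) 𝓘(ℝ, ℂ) ∞ f) :
    ∫ p, conj (char ξ p) * laplaceBeltrami Λ f p ∂(vol Λ) =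
      lam ξ * ∫ p, conj (char ξ p) * f p ∂(vol Λ) := by
  have hcc : Continuous fun p => conj (char ξ p) := continuous_conj.comp (continuous_char ξ)
  simp_rw [laplaceBeltrami_eq_sum hf, mul_neg, Finset.mul_sum]
  have hint : ∀ v : E n, Integrable
      (fun p => conj (char ξ p) * dirDeriv v (dirDeriv v f) p) (vol Λ) := fun v =>
    integrable_of_continuous
      (hcc.mul (contMDiff_dirDeriv _ (contMDiff_dirDeriv _ hf)).continuous)
  rw [integral_neg, integral_finsetSum _ fun i _ => hint _]
  have hsq : ∀ v : E n, ∫ p, conj (char ξ p) * dirDeriv v (dirDeriv v f) p ∂(vol Λ) =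
      (2 * Real.pi * I * inner ℝ (ξ : E n) v : ℂ) ^ 2 * ∫ p, conj (char ξ p) * f p ∂(vol Λ) := by
    intro v
    rw [integral_conj_char_mul_dirDeriv ξ v (contMDiff_dirDeriv v hf),
      integral_conj_char_mul_dirDeriv ξ v hf]
    ring
  simp only [hsq]
  rw [← Finset.sum_mul, sum_sq_inner]
  ring

lemma inner_charBasis {u : L2 Λ} {f : Torus Λ → ℂ} (hu : u =ᵐ[vol Λ] f) (ξ : dual Λ) :
    inner ℂ (charBasis Λ ξ) u = (((Real.sqrt ((vol Λ).real Set.univ))⁻¹ : ℝ) : ℂ) *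
      ∫ p, conj (char ξ p) * f p ∂(vol Λ) := by
  rw [L2.inner_def, ← integral_const_mul, coe_charBasis]
  refine integral_congr_ae ?_
  filter_upwards [hu, charLp_ae ξ] with p h1 h2
  rw [h1, h2]
  simp only [RCLike.inner_apply, map_mul, conj_ofReal]
  ring

/-- Taking Fourier coefficients of the eigenvalue equation gives `(ev - lam ξ) * c = 0` for the
coefficient `c` at `ξ`. -/
lemma inner_charBasis_eq_zero {ev : ℝ} {u : L2 Λ} (hu : u ∈ eigenspace Λ ev) {ξ : dual Λ}
    (hξ : lam ξ ≠ ev) : inner ℂ (charBasis Λ ξ) u = 0 := by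
  obtain ⟨f, hf, hev, hae⟩ := hu
  have h := integral_conj_char_mul_laplaceBeltrami ξ hf
  simp_rw [hev, mul_left_comm _ (ev : ℂ)] at h
  rw [integral_const_mul] at h
  rw [inner_charBasis hae]
  have h0 : ((ev : ℂ) - lam ξ) ≠ 0 := by
    rw [sub_ne_zero]
    exact_mod_cast hξ.symm
  have h1 : ((ev : ℂ) - lam ξ) * ∫ p, conj (char ξ p) * f p ∂(vol Λ) = 0 := by
    rw [sub_mul, h, sub_self]
  rw [(mul_eq_zero.1 h1).resolve_left h0, mul_zero]

lemma charBasis_mem_eigenspace (ξ : dual Λ) : charBasis Λ ξ ∈ eigenspace Λ (lam ξ) := by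
  refine ⟨fun p => (((Real.sqrt ((vol Λ).real Set.univ))⁻¹ : ℝ) : ℂ) * char ξ p,
    contMDiff_const_mul_char _ ξ, laplaceBeltrami_char ξ _, ?_⟩
  rw [coe_charBasis]
  exact charLp_ae ξ

lemma finite_lam_le (r : ℝ) : {ξ : dual Λ | lam ξ ≤ r}.Finite := by
  refine (finite_norm_le (dual Λ) (1 + r)).subset fun ξ hξ => ?_
  have h1 : lam ξ ≤ r := hξ
  have h2 : ‖ξ‖ ^ 2 ≤ lam ξ := by
    have : 1 ≤ 4 * Real.pi ^ 2 := by nlinarith [Real.pi_gt_three]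
    exact le_mul_of_one_le_left (sq_nonneg _) this
  simp only [Set.mem_ofPred_eq]
  nlinarith [sq_nonneg (‖ξ‖ - 1), norm_nonneg ξ]

lemma finite_lam_eq (r : ℝ) : {ξ : dual Λ | lam ξ = r}.Finite :=
  (finite_lam_le r).subset fun _ h => le_of_eq h

instance (r : ℝ) : Finite {ξ : dual Λ // lam ξ = r} := (finite_lam_eq r).to_subtype

lemma hasSum_of_mem_eigenspace {ev : ℝ} {u : L2 Λ} (hu : u ∈ eigenspace Λ ev) :
    HasSum (fun ξ : {ξ : dual Λ // lam ξ = ev} => inner ℂ (charBasis Λ ξ) u • charBasis Λ ξ) u := by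
  have h := (charBasis Λ).hasSum_repr u
  simp_rw [HilbertBasis.repr_apply_apply] at h
  refine (hasSum_subtype_iff_of_support_subset
    (f := fun ξ => inner ℂ (charBasis Λ ξ) u • charBasis Λ ξ)
    (s := {ξ : dual Λ | lam ξ = ev}) fun ξ hξ => ?_).2 h
  by_contra hne
  refine hξ ?_
  beta_reduce
  rw [inner_charBasis_eq_zero hu hne, zero_smul]

/-- Only the finitely many characters with `lam ξ = ev` can occur in the Fourier expansion of an
eigenfunction. Multiplicities of eigenvalues thus become counts of dual lattice vectors. -/
lemma eigenspace_eq_span (ev : ℝ) : eigenspace Λ ev =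
    Submodule.span ℂ (Set.range fun ξ : {ξ : dual Λ // lam ξ = ev} => charBasis Λ ξ) := by
  refine le_antisymm (fun u hu => ?_) (Submodule.span_le.2 ?_)
  · have := Fintype.ofFinite {ξ : dual Λ // lam ξ = ev}
    rw [(hasSum_of_mem_eigenspace hu).unique (hasSum_fintype _)]
    exact Submodule.sum_mem _ fun ξ _ => Submodule.smul_mem _ _ (Submodule.subset_span ⟨ξ, rfl⟩)
  · rintro _ ⟨⟨ξ, rfl⟩, rfl⟩
    exact charBasis_mem_eigenspace ξ

lemma rank_eigenspace (ev : ℝ) :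
    Module.rank ℂ (eigenspace Λ ev) = {ξ : dual Λ | lam ξ = ev}.ncard := by
  have hli : LinearIndependent ℂ fun ξ : {ξ : dual Λ // lam ξ = ev} => charBasis Λ ξ :=
    (charBasis Λ).orthonormal.linearIndependent.comp _ Subtype.val_injective
  rw [eigenspace_eq_span, rank_span hli, Cardinal.mk_range_eq _ hli.injective,
    Set.cast_ncard (finite_lam_eq ev)]
  rfl

lemma isospectral_iff {Λ₁ Λ₂ : Submodule ℤ (E n)} [DiscreteTopology Λ₁] [IsZLattice ℝ Λ₁]
    [DiscreteTopology Λ₂] [IsZLattice ℝ Λ₂] : Isospectral Λ₁ Λ₂ ↔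
      ∀ r : ℝ, {ξ : dual Λ₁ | lam ξ = r}.ncard = {ξ : dual Λ₂ | lam ξ = r}.ncard := by
  simp only [Isospectral, rank_eigenspace, Nat.cast_inj]

lemma eigenproj_apply (ev : ℝ) (u : L2 Λ) : eigenproj Λ ev u =
    ∑' ξ : {ξ : dual Λ // lam ξ = ev}, inner ℂ (charBasis Λ ξ) u • charBasis Λ ξ := by
  have := Fintype.ofFinite {ξ : dual Λ // lam ξ = ev}
  rw [tsum_fintype, eigenproj]
  refine Submodule.eq_starProjection_of_mem_orthogonal
    (Submodule.le_topologicalClosure _ (Submodule.sum_mem _ fun ξ _ => ?_)) ?_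
  · refine Submodule.smul_mem _ _ ?_
    have := charBasis_mem_eigenspace ξ.1
    rwa [ξ.2] at this
  · rw [Submodule.orthogonal_closure, Submodule.mem_orthogonal]
    intro w hw
    rw [eigenspace_eq_span] at hw
    induction hw using Submodule.span_induction with
    | mem x hx =>
      obtain ⟨η, rfl⟩ := hx
      have horth := (charBasis Λ).orthonormal.comp _
        (Subtype.val_injective (p := fun ξ : dual Λ => lam ξ = ev))
      have := horth.inner_right_sum (fun ξ => inner ℂ (charBasis Λ ξ) u) (Finset.mem_univ η)
      rw [inner_sub_right, sub_eq_zero]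
      exact this.symm
    | zero => simp
    | add x y _ _ hx hy => rw [inner_add_left, hx, hy, add_zero]
    | smul c x _ hx => rw [inner_smul_left, hx, mul_zero]

end Eigenspaces

/-! ### The trace of `a Δ^{-s}` -/

section Trace

variable {n : ℕ} {Λ : Submodule ℤ (E n)}

lemma lam_pos {ξ : dual Λ} (hξ : ξ ≠ 0) : 0 < lam ξ := by
  have := norm_pos_iff.2 hξ
  unfold lam
  positivity

lemma lam_zero : lam (0 : dual Λ) = 0 := by simp [lam]

lemma norm_lam_cpow (s : ℂ) (ξ : {ξ : dual Λ // ξ ≠ 0}) :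
    ‖((lam (ξ : dual Λ) : ℝ) : ℂ) ^ (-s)‖ = lam (ξ : dual Λ) ^ (-s.re) := by
  rw [norm_cpow_eq_rpow_re_of_pos (lam_pos ξ.2), neg_re]

variable [DiscreteTopology Λ] [IsZLattice ℝ Λ]

lemma summable_lam_rpow {s : ℝ} (hs : (n : ℝ) / 2 < s) :
    Summable fun ξ : {ξ : dual Λ // ξ ≠ 0} => lam (ξ : dual Λ) ^ (-s) := by
  have h := ZLattice.summable_norm_rpow (dual Λ) (-(2 * s)) (by
    rw [ZLattice.rank ℝ, finrank_euclideanSpace_fin]; linarith)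
  have h1 : ∀ ξ : dual Λ, lam ξ ^ (-s) = (4 * Real.pi ^ 2) ^ (-s) * ‖ξ‖ ^ (-(2 * s)) := by
    intro ξ
    rw [lam, Real.mul_rpow (by positivity) (by positivity), ← Real.rpow_natCast ‖ξ‖ 2,
      ← Real.rpow_mul (norm_nonneg _)]
    congr 2
    push_cast
    ring
  have h2 : Summable fun ξ : dual Λ => lam ξ ^ (-s) := by
    simp_rw [h1]
    exact h.mul_left _
  exact h2.comp_injective Subtype.val_injective

/-- The spectral expansion of `Δ^{-s}` in the Fourier basis. -/
lemma hasSum_powLaplace {s : ℂ} (hs : (n : ℝ) / 2 < s.re) (u : L2 Λ) :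
    HasSum (fun ξ : {ξ : dual Λ // ξ ≠ 0} => ((lam (ξ : dual Λ) : ℝ) : ℂ) ^ (-s) •
      inner ℂ (charBasis Λ ξ) u • charBasis Λ ξ) (powLaplace Λ s u) := by
  have hsum : Summable (fun ξ : {ξ : dual Λ // ξ ≠ 0} => ((lam (ξ : dual Λ) : ℝ) : ℂ) ^ (-s) •
      inner ℂ (charBasis Λ ξ) u • charBasis Λ ξ) := by
    refine Summable.of_norm_bounded ((summable_lam_rpow hs).mul_right ‖u‖) fun ξ => ?_
    have h1 := (charBasis Λ).orthonormal.1 (ξ : dual Λ)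
    rw [norm_smul, norm_smul, norm_lam_cpow, h1, mul_one]
    refine mul_le_mul_of_nonneg_left ?_ (Real.rpow_nonneg (lam_pos ξ.2).le _)
    refine (norm_inner_le_norm _ _).trans ?_
    rw [h1, one_mul]
  -- Grouping the nonzero `ξ` by eigenvalue gives the defining sum over all positive reals; those
  -- that are not eigenvalues have empty fibres.
  have hfib := hsum.hasSum.tsum_fiberwise
    (fun ξ : {ξ : dual Λ // ξ ≠ 0} => (⟨lam (ξ : dual Λ), lam_pos ξ.2⟩ : Set.Ioi (0 : ℝ)))
  convert hsum.hasSum using 1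
  rw [← hfib.tsum_eq, powLaplace]
  refine tsum_congr fun ev => ?_
  let e : ((fun ξ : {ξ : dual Λ // ξ ≠ 0} =>
      (⟨lam (ξ : dual Λ), lam_pos ξ.2⟩ : Set.Ioi (0 : ℝ))) ⁻¹' {ev}) ≃
      {ξ : dual Λ // lam ξ = ev} :=
    { toFun := fun ξ => ⟨ξ.1.1, congrArg Subtype.val ξ.2⟩
      invFun := fun ξ => ⟨⟨ξ.1, fun h => by
        have h1 := ev.2
        have h2 := ξ.2
        rw [h, lam_zero] at h2
        rw [← h2] at h1
        exact lt_irrefl (0 : ℝ) h1⟩, Subtype.ext ξ.2⟩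
      left_inv := fun _ => rfl
      right_inv := fun _ => rfl }
  rw [eigenproj_apply, ← e.tsum_eq, ← tsum_const_smul'']
  refine tsum_congr fun ξ => ?_
  have h : lam (ξ.1 : dual Λ) = ev := congrArg Subtype.val ξ.2
  rw [h]
  rfl

lemma memLp_mul (a : C(Torus Λ, ℝ)) (v : L2 Λ) :
    MemLp (fun p => (a p : ℂ) * v p) 2 (vol Λ) := by
  have hc : Continuous fun p => (a p : ℂ) := continuous_ofReal.comp a.continuous
  refine MemLp.of_le_mul (c := ‖a‖) (Lp.memLp v)
    (hc.aestronglyMeasurable.mul (Lp.aestronglyMeasurable v)) (Eventually.of_forall fun p => ?_)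
  rw [norm_mul, norm_real]
  exact mul_le_mul_of_nonneg_right (a.norm_coe_le_norm p) (norm_nonneg _)

/-- Multiplication by a continuous function on `L²(T)`. -/
def mulLp (a : C(Torus Λ, ℝ)) (v : L2 Λ) : L2 Λ := (memLp_mul a v).toLp

lemma mulLp_ae (a : C(Torus Λ, ℝ)) (v : L2 Λ) : mulLp a v =ᵐ[vol Λ] fun p => (a p : ℂ) * v p :=
  MemLp.coeFn_toLp _

lemma inner_mulLp_right (a : C(Torus Λ, ℝ)) (v w : L2 Λ) :
    inner ℂ v (mulLp a w) = ∫ p, conj (v p) * ((a p : ℂ) * w p) ∂(vol Λ) := by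
  rw [L2.inner_def]
  refine integral_congr_ae ?_
  filter_upwards [mulLp_ae a w] with p h
  rw [h, RCLike.inner_apply, mul_comm]

lemma inner_mulLp_left (a : C(Torus Λ, ℝ)) (v w : L2 Λ) :
    inner ℂ (mulLp a v) w = inner ℂ v (mulLp a w) := by
  rw [inner_mulLp_right, L2.inner_def]
  refine integral_congr_ae ?_
  filter_upwards [mulLp_ae a v] with p h
  rw [h, RCLike.inner_apply, map_mul, conj_ofReal]
  ring

/-- The factor `conj χ * χ` is 1, so `ξ` drops out. This is why the zeta function splits into a mean
value and a spectral series. -/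
lemma inner_charBasis_mulLp (a : C(Torus Λ, ℝ)) (ξ : dual Λ) :
    inner ℂ (charBasis Λ ξ) (mulLp a (charBasis Λ ξ)) =
      ((∫ p, a p ∂(vol Λ)) / (vol Λ).real Set.univ : ℝ) := by
  have h : mulLp a (charBasis Λ ξ) =ᵐ[vol Λ]
      fun p => (((Real.sqrt ((vol Λ).real Set.univ))⁻¹ : ℝ) : ℂ) * (a p * char ξ p) := by
    rw [coe_charBasis]
    filter_upwards [mulLp_ae a (charLp ξ), charLp_ae ξ] with p h1 h2
    rw [h1, h2]
    ring
  rw [inner_charBasis h]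
  simp_rw [mul_left_comm _ (((Real.sqrt ((vol Λ).real Set.univ))⁻¹ : ℝ) : ℂ)]
  rw [integral_const_mul, ← mul_assoc, inv_sqrt_vol_mul_self]
  simp_rw [mul_left_comm _ ((a _ : ℝ) : ℂ), conj_char_mul_char, mul_one]
  rw [integral_complex_ofReal]
  push_cast
  ring

/-- A product of coefficients in a Hilbert basis is absolutely summable, with a uniform bound. -/
lemma summable_norm_inner_mul_inner {ι H : Type*} [NormedAddCommGroup H] [InnerProductSpace ℂ H]
    (b : HilbertBasis ι ℂ H) (x y : H) :
    Summable (fun i => ‖inner ℂ x (b i) * inner ℂ (b i) y‖) ∧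
      ∑' i, ‖inner ℂ x (b i) * inner ℂ (b i) y‖ ≤ ‖x‖ ^ 2 + ‖y‖ ^ 2 := by
  have key : ∀ z : H, HasSum (fun i => ‖inner ℂ (b i) z‖ ^ 2) (‖z‖ ^ 2) := by
    intro z
    have h := b.hasSum_inner_mul_inner z z
    rw [inner_self_eq_norm_sq_to_K] at h
    have h2 : ∀ i, inner ℂ z (b i) * inner ℂ (b i) z = ((‖inner ℂ (b i) z‖ ^ 2 : ℝ) : ℂ) := by
      intro i
      rw [← inner_conj_symm z (b i), conj_mul']
      push_cast
      rfl
    simp_rw [h2] at h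
    have h3 : HasSum (fun i => ((‖inner ℂ (b i) z‖ ^ 2 : ℝ) : ℂ)) ((‖z‖ ^ 2 : ℝ) : ℂ) := by
      rw [ofReal_pow ‖z‖]
      exact h
    exact Complex.hasSum_ofReal.1 h3
  have hle : ∀ i, ‖inner ℂ x (b i) * inner ℂ (b i) y‖ ≤
      ‖inner ℂ (b i) x‖ ^ 2 + ‖inner ℂ (b i) y‖ ^ 2 := by
    intro i
    rw [norm_mul, norm_inner_symm]
    nlinarith [sq_nonneg (‖inner ℂ (b i) x‖ - ‖inner ℂ (b i) y‖),
      sq_nonneg ‖inner ℂ (b i) x‖, sq_nonneg ‖inner ℂ (b i) y‖]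
  have hs := (key x).add (key y)
  have hsum := Summable.of_nonneg_of_le (fun i => norm_nonneg _) hle hs.summable
  exact ⟨hsum, hsum.tsum_le_of_sum_le fun t => (Finset.sum_le_sum fun i _ => hle i).trans
    (sum_le_hasSum t (fun i _ => by positivity) hs)⟩

lemma norm_mulLp_le (a : C(Torus Λ, ℝ)) (v : L2 Λ) : ‖mulLp a v‖ ≤ ‖a‖ * ‖v‖ := by
  refine Lp.norm_le_mul_norm_of_ae_le_mul ?_
  filter_upwards [mulLp_ae a v] with p h
  rw [h, norm_mul, norm_real]
  exact mul_le_mul_of_nonneg_right (a.norm_coe_le_norm p) (norm_nonneg _)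

/-- The trace of `a Δ^{-s}` may be computed in any Hilbert basis. -/
lemma tsum_inner_mul_powLaplace {ι : Type*} (b : HilbertBasis ι ℂ (L2 Λ)) (a : C(Torus Λ, ℝ))
    {s : ℂ} (hs : (n : ℝ) / 2 < s.re) :
    ∑' i, inner ℂ (b i) (mulLp a (powLaplace Λ s (b i))) =
      ((∫ p, a p ∂(vol Λ)) / (vol Λ).real Set.univ : ℝ) *
        ∑' ξ : {ξ : dual Λ // ξ ≠ 0}, ((lam (ξ : dual Λ) : ℝ) : ℂ) ^ (-s) := by
  let T : {ξ : dual Λ // ξ ≠ 0} → ι → ℂ := fun ξ i => ((lam (ξ : dual Λ) : ℝ) : ℂ) ^ (-s) *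
    (inner ℂ (charBasis Λ ξ) (b i) * inner ℂ (b i) (mulLp a (charBasis Λ ξ)))
  have h1 : ∀ i, inner ℂ (b i) (mulLp a (powLaplace Λ s (b i))) = ∑' ξ, T ξ i := by
    intro i
    have h := (hasSum_powLaplace hs (b i)).mapL (innerSL ℂ (mulLp a (b i)))
    simp only [innerSL_apply_apply, inner_smul_right, inner_mulLp_left] at h
    exact h.tsum_eq.symm
  -- Absolute summability permits exchanging the sums: the sum over `i` is at most a constant
  -- independent of `ξ` times `lam ξ ^ (-s.re)`. After the exchange, the sum over `i` is Parseval's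
  -- identity.
  have h2 : Summable (Function.uncurry T) := by
    refine Summable.of_norm ((summable_prod_of_nonneg fun _ => norm_nonneg _).2 ⟨fun ξ => ?_, ?_⟩)
    · simp only [Function.uncurry_apply_pair, T, norm_mul _ (inner ℂ _ _ * inner ℂ _ _)]
      exact (summable_norm_inner_mul_inner b _ _).1.mul_left _
    · refine Summable.of_nonneg_of_le (fun ξ => tsum_nonneg fun i => norm_nonneg _) (fun ξ => ?_)
        ((summable_lam_rpow hs).mul_right (1 ^ 2 + (‖a‖ * 1) ^ 2))
      simp only [Function.uncurry_apply_pair, T, norm_mul _ (inner ℂ _ _ * inner ℂ _ _)]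
      have hn := (charBasis Λ).orthonormal.1 (ξ : dual Λ)
      rw [tsum_mul_left, norm_lam_cpow]
      refine mul_le_mul_of_nonneg_left ((summable_norm_inner_mul_inner b _ _).2.trans ?_)
        (Real.rpow_nonneg (lam_pos ξ.2).le _)
      have h3 := norm_mulLp_le a (charBasis Λ ξ)
      rw [hn] at h3 ⊢
      gcongr
  simp_rw [h1]
  rw [h2.tsum_comm, ← tsum_mul_left]
  refine tsum_congr fun ξ => ?_
  simp only [T]
  rw [tsum_mul_left, (b.hasSum_inner_mul_inner _ _).tsum_eq, inner_charBasis_mulLp, mul_comm]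

theorem zetaTrace_eq (a : C^∞⟮𝓘(ℝ, E n), Torus Λ; ℝ⟯) {s : ℂ} (hs : (n : ℝ) / 2 < s.re) :
    zetaTrace Λ a s = ((∫ p, a p ∂(vol Λ)) / (vol Λ).real Set.univ : ℝ) *
      ∑' ξ : {ξ : dual Λ // ξ ≠ 0}, ((lam (ξ : dual Λ) : ℝ) : ℂ) ^ (-s) := by
  have h := tsum_inner_mul_powLaplace (exists_hilbertBasis ℂ (L2 Λ)).choose_spec.choose
    ⟨a, a.contMDiff.continuous⟩ hs
  simp only [inner_mulLp_right] at h
  exact h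

end Trace

/-! ### Comparison of zeta functions -/

section Zeta

variable {n : ℕ}

lemma zeta_eq_zetaTrace (Λ : Submodule ℤ (E n)) [DiscreteTopology Λ] [IsZLattice ℝ Λ]
    (a : C^∞⟮𝓘(ℝ, E n), Torus Λ; ℝ⟯) {s : ℂ} (hs : (n : ℝ) / 2 < s.re) :
    zeta Λ a s = zetaTrace Λ a s := by
  unfold zeta
  split_ifs with h
  · exact h.choose_spec.2 s hs
  · exact if_pos hs

lemma exists_equiv_of_ncard_eq {ι κ : Type*} {f : ι → ℝ} {g : κ → ℝ}
    (hf : ∀ r, {i | f i = r}.Finite) (hg : ∀ r, {i | g i = r}.Finite)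
    (h : ∀ r, {i | f i = r}.ncard = {i | g i = r}.ncard) : ∃ e : ι ≃ κ, ∀ i, g (e i) = f i := by
  obtain ⟨e, he⟩ := exists_equiv_of_card_fiber_eq hf hg (P := fun _ => True) fun r _ => h r
  exact ⟨(Equiv.subtypeUnivEquiv fun _ => trivial).symm.trans
    (e.trans (Equiv.subtypeUnivEquiv fun _ => trivial)), fun i => he ⟨i, trivial⟩⟩

section

variable {Λ : Submodule ℤ (E n)}

lemma lam_eq_zero_iff {ξ : dual Λ} : lam ξ = 0 ↔ ξ = 0 :=
  ⟨fun h => by_contra fun hne => (lam_pos hne).ne' h, fun h => h ▸ lam_zero⟩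

lemma ncard_lam_eq_zero : {ξ : dual Λ | lam ξ = 0}.ncard = 1 := by
  simp only [lam_eq_zero_iff, Set.ofPred_eq_eq_singleton, Set.ncard_singleton]

lemma ncard_ne_zero_lam_eq_zero :
    {ξ : {ξ : dual Λ // ξ ≠ 0} | lam (ξ : dual Λ) = 0}.ncard = 0 := by
  have : {ξ : {ξ : dual Λ // ξ ≠ 0} | lam (ξ : dual Λ) = 0} = ∅ :=
    Set.eq_empty_of_forall_notMem fun ξ hξ => ξ.2 (lam_eq_zero_iff.1 hξ)
  rw [this, Set.ncard_empty]

lemma ncard_ne_zero_lam_eq {r : ℝ} (hr : r ≠ 0) :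
    {ξ : {ξ : dual Λ // ξ ≠ 0} | lam (ξ : dual Λ) = r}.ncard =
      {ξ : dual Λ | lam ξ = r}.ncard := by
  rw [← Set.ncard_image_of_injective _ Subtype.val_injective]
  congr 1
  ext ξ
  constructor
  · rintro ⟨η, hη, rfl⟩
    exact hη
  · intro hξ
    exact ⟨⟨ξ, fun h => hr (by rw [← hξ, h, lam_zero])⟩, hξ, rfl⟩

lemma tsum_lam_cpow_ofReal (s : ℝ) :
    ∑' ξ : {ξ : dual Λ // ξ ≠ 0}, ((lam (ξ : dual Λ) : ℝ) : ℂ) ^ (-(s : ℂ)) =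
      ((∑' ξ : {ξ : dual Λ // ξ ≠ 0}, lam (ξ : dual Λ) ^ (-s) : ℝ) : ℂ) := by
  rw [ofReal_tsum]
  refine tsum_congr fun ξ => ?_
  rw [ofReal_cpow (lam_pos ξ.2).le, ofReal_neg]

end

variable {Λ₁ Λ₂ : Submodule ℤ (E n)} [DiscreteTopology Λ₁] [IsZLattice ℝ Λ₁]
  [DiscreteTopology Λ₂] [IsZLattice ℝ Λ₂]

/-- Zeta functions are determined by their values on the half-plane of convergence. -/
lemma zeta_eq_zeta_iff (a₁ : C^∞⟮𝓘(ℝ, E n), Torus Λ₁; ℝ⟯) (a₂ : C^∞⟮𝓘(ℝ, E n), Torus Λ₂; ℝ⟯) :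
    zeta Λ₁ a₁ = zeta Λ₂ a₂ ↔
      ∀ s : ℂ, (n : ℝ) / 2 < s.re → zetaTrace Λ₁ a₁ s = zetaTrace Λ₂ a₂ s := by
  constructor
  · intro h s hs
    rw [← zeta_eq_zetaTrace Λ₁ a₁ hs, ← zeta_eq_zetaTrace Λ₂ a₂ hs, h]
  · intro h
    -- Equal traces give equal predicates, hence the same chosen function, and equal fallback
    -- values. Neither existence nor uniqueness of the continuation enters.
    have hP : IsZeta Λ₁ a₁ = IsZeta Λ₂ a₂ := by
      funext F
      refine propext (and_congr_right fun _ => forall_congr' fun s => forall_congr' fun hs => ?_)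
      rw [h s hs]
    have hQ : (fun s : ℂ => if (n : ℝ) / 2 < s.re then zetaTrace Λ₁ a₁ s else 0) =
        fun s : ℂ => if (n : ℝ) / 2 < s.re then zetaTrace Λ₂ a₂ s else 0 := by
      funext s
      split_ifs with hs
      · exact h s hs
      · rfl
    unfold zeta
    rw [hQ]
    generalize IsZeta Λ₁ a₁ = P at hP
    subst hP
    rfl

lemma finite_ne_zero_lam_le (r : ℝ) : {ξ : {ξ : dual Λ₁ // ξ ≠ 0} | lam (ξ : dual Λ₁) ≤ r}.Finite :=
  (finite_lam_le r).preimage Subtype.val_injective.injOn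

/-- The eigenvalue 0, invisible to the zeta function, has multiplicity one on every flat torus. -/
lemma isospectral_iff_ne_zero : Isospectral Λ₁ Λ₂ ↔
    ∀ r : ℝ, {ξ : {ξ : dual Λ₁ // ξ ≠ 0} | lam (ξ : dual Λ₁) = r}.ncard =
      {ξ : {ξ : dual Λ₂ // ξ ≠ 0} | lam (ξ : dual Λ₂) = r}.ncard := by
  rw [isospectral_iff]
  refine forall_congr' fun r => ?_
  rcases eq_or_ne r 0 with rfl | hr
  · simp only [ncard_lam_eq_zero, ncard_ne_zero_lam_eq_zero]
  · rw [ncard_ne_zero_lam_eq hr, ncard_ne_zero_lam_eq hr]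

/-- The spectrum determines the volume of a flat torus. -/
lemma Isospectral.vol_eq (hn : 0 < n) (h : Isospectral Λ₁ Λ₂) :
    (vol Λ₁).real Set.univ = (vol Λ₂).real Set.univ := by
  obtain ⟨e, he⟩ := exists_equiv_of_ncard_eq finite_lam_eq finite_lam_eq (isospectral_iff.1 h)
  have hd : ZLattice.covolume (dual Λ₁) = ZLattice.covolume (dual Λ₂) := by
    refine covolume_eq_of_equiv hn e fun ξ => ?_
    have h1 := he ξ
    rw [lam, lam] at h1
    have h2 := mul_left_cancel₀ (by positivity) h1
    exact (pow_left_inj₀ (norm_nonneg _) (norm_nonneg _) two_ne_zero).1 h2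
  have h1 := covolume_mul_covolume_dual Λ₁
  rw [← covolume_mul_covolume_dual Λ₂, hd] at h1
  rw [vol_real_univ, vol_real_univ]
  exact mul_right_cancel₀ (ZLattice.covolume_ne_zero _ _) h1

lemma Isospectral.tsum_lam_cpow_eq (h : Isospectral Λ₁ Λ₂) (s : ℂ) :
    ∑' ξ : {ξ : dual Λ₁ // ξ ≠ 0}, ((lam (ξ : dual Λ₁) : ℝ) : ℂ) ^ (-s) =
      ∑' ξ : {ξ : dual Λ₂ // ξ ≠ 0}, ((lam (ξ : dual Λ₂) : ℝ) : ℂ) ^ (-s) := by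
  obtain ⟨e, he⟩ := exists_equiv_of_ncard_eq
    (fun r => (finite_ne_zero_lam_le r).subset fun _ h => le_of_eq h)
    (fun r => (finite_ne_zero_lam_le r).subset fun _ h => le_of_eq h) (isospectral_iff_ne_zero.1 h)
  rw [← e.tsum_eq]
  exact tsum_congr fun ξ => by rw [he]

/-- Flat tori with the same spectral zeta function are isospectral. -/
lemma isospectral_of_tsum_eq
    (h : ∀ s : ℂ, (n : ℝ) / 2 < s.re →
      ∑' ξ : {ξ : dual Λ₁ // ξ ≠ 0}, ((lam (ξ : dual Λ₁) : ℝ) : ℂ) ^ (-s) =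
        ∑' ξ : {ξ : dual Λ₂ // ξ ≠ 0}, ((lam (ξ : dual Λ₂) : ℝ) : ℂ) ^ (-s)) :
    Isospectral Λ₁ Λ₂ := by
  -- Any `s₀ > n / 2` would serve.
  refine isospectral_iff_ne_zero.2 (ncard_eq_of_tsum_rpow_eq (s₀ := (n : ℝ) / 2 + 1)
    (fun ξ => lam_pos ξ.2) (fun ξ => lam_pos ξ.2) finite_ne_zero_lam_le finite_ne_zero_lam_le
    (fun s hs => summable_lam_rpow (by linarith)) (fun s hs => summable_lam_rpow (by linarith))
    fun s hs => ?_)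
  have := h s (by rw [ofReal_re]; linarith)
  rw [tsum_lam_cpow_ofReal, tsum_lam_cpow_ofReal] at this
  exact_mod_cast this

/-- Lets the series be cancelled to leave an equality of means. Positive dimension supplies a
nonzero dual vector. -/
lemma tsum_lam_rpow_pos (hn : 0 < n) {s : ℝ} (hs : (n : ℝ) / 2 < s) :
    0 < ∑' ξ : {ξ : dual Λ₁ // ξ ≠ 0}, lam (ξ : dual Λ₁) ^ (-s) := by
  obtain ⟨ξ, hξ⟩ : ∃ ξ : dual Λ₁, ξ ≠ 0 := by
    have : Nontrivial (dual Λ₁) := by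
      refine Module.nontrivial_of_finrank_pos (R := ℤ) ?_
      rw [ZLattice.rank ℝ, finrank_euclideanSpace_fin]
      exact hn
    exact exists_ne 0
  exact (summable_lam_rpow hs).tsum_pos (fun ξ => Real.rpow_nonneg (lam_pos ξ.2).le _) ⟨ξ, hξ⟩
    (Real.rpow_pos_of_pos (lam_pos hξ) _)

/-- Equality of all weighted zeta functions, in terms of spectra and integrals. -/
lemma forall_zetaTrace_eq_iff (hn : 0 < n)
    (φ : Diffeomorph 𝓘(ℝ, E n) 𝓘(ℝ, E n) (Torus Λ₁) (Torus Λ₂) ∞) :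
    (∀ a : C^∞⟮𝓘(ℝ, E n), Torus Λ₂; ℝ⟯, zeta Λ₂ a = zeta Λ₁ (a.comp φ.toContMDiffMap)) ↔
      Isospectral Λ₁ Λ₂ ∧ ∀ a : C^∞⟮𝓘(ℝ, E n), Torus Λ₂; ℝ⟯,
        (∫ q, a q ∂(vol Λ₂)) / (vol Λ₂).real Set.univ =
          (∫ p, a (φ p) ∂(vol Λ₁)) / (vol Λ₁).real Set.univ := by
  simp only [zeta_eq_zeta_iff]
  constructor
  · intro h
    have hiso : Isospectral Λ₁ Λ₂ := by
      refine isospectral_of_tsum_eq fun s hs => ?_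
      -- The constant weight 1 has mean 1 on both tori, so only the spectral series remain.
      have h1 := h 1 s hs
      rw [zetaTrace_eq _ hs, zetaTrace_eq _ hs] at h1
      have e1 : (∫ q, (1 : C^∞⟮𝓘(ℝ, E n), Torus Λ₂; ℝ⟯) q ∂(vol Λ₂)) =
          (vol Λ₂).real Set.univ := by simp
      have e2 : (∫ p, ((1 : C^∞⟮𝓘(ℝ, E n), Torus Λ₂; ℝ⟯).comp φ.toContMDiffMap) p ∂(vol Λ₁)) =
          (vol Λ₁).real Set.univ := by simp
      rw [e1, e2, div_self (vol_real_univ_pos _).ne', div_self (vol_real_univ_pos _).ne'] at h1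
      simpa using h1.symm
    refine ⟨hiso, fun a => ?_⟩
    have hs : (n : ℝ) / 2 < (((n : ℝ) / 2 + 1 : ℝ) : ℂ).re := by rw [ofReal_re]; linarith
    have h1 := h a _ hs
    rw [zetaTrace_eq _ hs, zetaTrace_eq _ hs, hiso.tsum_lam_cpow_eq, tsum_lam_cpow_ofReal] at h1
    have h2 := mul_right_cancel₀
      (ofReal_ne_zero.2 (tsum_lam_rpow_pos hn (by linarith)).ne') h1
    exact_mod_cast h2
  · rintro ⟨hiso, h⟩ a s hs
    rw [zetaTrace_eq _ hs, zetaTrace_eq _ hs, hiso.tsum_lam_cpow_eq, h a]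
    rfl

/-- Two tori of the same volume: a diffeomorphism between them has jacobian one if and only if it
preserves mean values. -/
lemma forall_integral_eq_iff_jacobian (hV : (vol Λ₁).real Set.univ = (vol Λ₂).real Set.univ)
    (φ : Diffeomorph 𝓘(ℝ, E n) 𝓘(ℝ, E n) (Torus Λ₁) (Torus Λ₂) ∞) :
    (∀ a : C^∞⟮𝓘(ℝ, E n), Torus Λ₂; ℝ⟯, (∫ q, a q ∂(vol Λ₂)) / (vol Λ₂).real Set.univ =
      (∫ p, a (φ p) ∂(vol Λ₁)) / (vol Λ₁).real Set.univ) ↔ ∀ p, jacobian φ p = 1 := by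
  rw [hV]
  constructor
  · intro h
    have hc := continuous_jacobian φ.contMDiff
    have hae : jacobian φ =ᵐ[vol Λ₁] fun _ => 1 := by
      refine ae_eq_of_integral_contMDiff_smul_eq 𝓘(ℝ, E n)
        (integrable_of_continuous hc).locallyIntegrable
        (integrable_const _).locallyIntegrable fun g hg _ => ?_
      -- Transporting `g` by the inverse of `φ` reaches every smooth test function on the first
      -- torus, and the integral of `a` becomes that of `w_φ * g`.
      let a : C^∞⟮𝓘(ℝ, E n), Torus Λ₂; ℝ⟯ := ⟨g ∘ φ.symm, hg.comp φ.symm.contMDiff⟩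
      have ha : ∀ p, a (φ p) = g p := fun p => congrArg g (φ.symm_apply_apply p)
      have h1 := h a
      rw [div_left_inj' (vol_real_univ_pos _).ne', integral_comp_mul_jacobian φ] at h1
      simp_rw [ha] at h1
      simpa [mul_comm] using h1
    exact fun p => congrFun ((hc.ae_eq_iff_eq (vol Λ₁) continuous_const).1 hae) p
  · intro h a
    rw [integral_comp_mul_jacobian φ]
    simp [h]

end Zeta

end FlatTorus

end

theorem mainTheorem9 (n : ℕ) (hn : 0 < n)
    (Λ₁ Λ₂ : Submodule ℤ (EuclideanSpace ℝ (Fin n)))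
    [DiscreteTopology Λ₁] [IsZLattice ℝ Λ₁] [DiscreteTopology Λ₂] [IsZLattice ℝ Λ₂]
    (φ : Diffeomorph 𝓘(ℝ, EuclideanSpace ℝ (Fin n)) 𝓘(ℝ, EuclideanSpace ℝ (Fin n))
      (FlatTorus.Torus Λ₁) (FlatTorus.Torus Λ₂) ∞) :
    (∀ a₀ : C^∞⟮𝓘(ℝ, EuclideanSpace ℝ (Fin n)), FlatTorus.Torus Λ₂; ℝ⟯,
        FlatTorus.zeta Λ₂ a₀ = FlatTorus.zeta Λ₁ (a₀.comp φ.toContMDiffMap)) ↔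
      FlatTorus.Isospectral Λ₁ Λ₂ ∧ ∀ p : FlatTorus.Torus Λ₁, FlatTorus.jacobian φ p = 1 :=
  (FlatTorus.forall_zetaTrace_eq_iff hn φ).trans
    (and_congr_right fun h => FlatTorus.forall_integral_eq_iff_jacobian (h.vol_eq hn) φ)
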